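/- **Theorem 7.** Notation. $\widehat f(\xi)=\int_{\mathbb R^d} f(x)e^{-2\pi i(x,\xi)}dx$ for $f\in L_1(\mathbb R^d)$, extended to $L_2(\mathbb R^d)$ by Plancherel's theorem; $\|f\|_{p,v}=\|fv\|_{L_p(\mathbb R^d)}$ and $L_{p,v}=\{f:\|f\|_{p,v}<\infty\}$; $\langle f,g\rangle=\int_{\mathbb R^d} f\overline g$. A dilation matrix is a real $d\times d$ matrix all of whose eigenvalues have modulus greater than $1$; $m=|\det M|$, $M^*$ is the transpose of $M$, and $\phi_{jk}(x)=m^{j/2}\phi(M^jx+k)$. The space $\mathcal L_{p,v}$ consists of the functions $\phi\in L_{p,v}$ with $\big\|\sum_{k\in\mathbb Z^d}|(\phi v)(\cdot+k)|\big\|_{L_p([-1/2,1/2]^d)}<\infty$. For a function $h$ defined up to null sets, $\operatorname{supp}h\subset A$ means that $h=0$ almost everywhere outside $A$. For bounded measurable $A\subset\mathbb R^d$, $$E_A(f)_{p,v}=\inf\{\|f-g\|_{p,v}: g\in L_{p,v}\cap L_2,\ \operatorname{supp}\widehat g\subset A\}.$$ Let $\alpha>0$ and $w\in\mathcal W^\alpha$,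 that is: $w:\mathbb R^d\to[1,\infty)$ is continuous and even, and there is an even measurable function $w^*:\mathbb R^d\to[0,\infty)$ such that $w(x+y)\le w^*(x)w(y)$ and $w^*(x)\le c_w(1+|x|^2)^{\alpha/2}$ for all $x,y$, with some constant $c_w>0$, and such that for every dilation matrix $N$ there is a constant $C'>0$ with $w^*(N^{-j}x)\le C'w^*(x)$ for all $x\in\mathbb R^d$ and all integers $j\ge0$. Fix such a $w^*$. Let $1\le p\le\infty$, $1/p+1/q=1$, and let $M$ be a dilation matrix. Suppose that 1. $\varphi\in\mathcal L_{p,w^*}\cap L_2$ and $\widetilde\varphi\in\mathcal L_{q,w^*}$; 2. $\varphi$ and $\widetilde\varphi$ are strictly compatible with respect to the parameter $\delta>0$, i.e. $\overline{\widehat\varphi(\xi)}\,\widehat{\widetilde\varphi}(\xi)=1$ for almost every $\xi$ with $|\xi|<\delta$; 3. $\operatorname{supp}\widehat\varphi\subset(-1,1)^d$, and $\delta$ is so small that $\widehat\varphi(\xi)=0$ for almost every $\xi$ with $|\xi-l|<\delta$, for every $l\in\mathbb Z^d\setminus\{0\}$. Then there is a constant $C$ such that for every $f\in L_{p,1/w}$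 and every integer $j\ge0$ the coefficients $\langle f,\widetilde\varphi_{jk}\rangle$ are well defined (the integrals converge absolutely), the series $$Q_jf=\sum_{k\in\mathbb Z^d}\langle f,\widetilde\varphi_{jk}\rangle\varphi_{jk}$$ converges absolutely almost everywhere to a function in $L_{p,1/w}$, and $$\|f-Q_jf\|_{p,1/w}\le C\,E_{\{\xi:\,|M^{*-j}\xi|<\delta\}}(f)_{p,1/w}.$$ -/

import Mathlib

open MeasureTheory Set
open scoped ENNReal NNReal FourierTransform ComplexConjugate

noncomputable section

namespace QuasiProj

/-- Euclidean space `ℝ^d`. -/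
abbrev E (d : ℕ) := EuclideanSpace ℝ (Fin d)

/-- The integer lattice point `k ∈ ℤ^d` as a vector of `ℝ^d`. -/
def latticePt {d : ℕ} (k : Fin d → ℤ) : E d := WithLp.toLp 2 (fun i => (k i : ℝ))

/-- The cube `𝕋^d = [-1/2, 1/2]^d`. -/
def unitCube (d : ℕ) : Set (E d) := {x | ∀ i, x i ∈ Icc (-(1 / 2) : ℝ) (1 / 2)}

/-- The action `x ↦ M x` of a real matrix on `ℝ^d`. -/
def act {d : ℕ} (M : Matrix (Fin d) (Fin d) ℝ) (x : E d) : E d := Matrix.toEuclideanLin M x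

/-- Dilation matrices: real matrices all of whose (complex) eigenvalues have modulus `> 1`. -/
def IsDilation {d : ℕ} (M : Matrix (Fin d) (Fin d) ℝ) : Prop :=
  ∀ z ∈ spectrum ℂ (M.map (fun r : ℝ => (r : ℂ))), 1 < ‖z‖

/-- `w` belongs to the class `𝒲^α`, with `w^* = ws` as the dominating function. -/
structure IsWeight {d : ℕ} (α : ℝ) (w ws : E d → ℝ) : Prop where
  one_le : ∀ x, 1 ≤ w x
  continuous : Continuous w
  even : ∀ x, w (-x) = w x
  star_nonneg : ∀ x, 0 ≤ ws x
  star_even : ∀ x, ws (-x) = ws x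
  star_measurable : Measurable ws
  submul : ∀ x y, w (x + y) ≤ ws x * w y
  growth : ∃ c : ℝ, 0 < c ∧ ∀ x, ws x ≤ c * (1 + ‖x‖ ^ 2) ^ (α / 2)
  dilation : ∀ M : Matrix (Fin d) (Fin d) ℝ, IsDilation M →
    ∃ C : ℝ, 0 < C ∧ ∀ (j : ℕ) (x : E d), ws (act (M⁻¹ ^ j) x) ≤ C * ws x

/-- The weighted norm `‖f‖_{p,v} = ‖f v‖_{L_p(ℝ^d)}`, with value in `[0,∞]`. -/
def wNorm {d : ℕ} (f : E d → ℂ) (p : ℝ≥0∞) (v : E d → ℝ) : ℝ≥0∞ :=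
  eLpNorm (fun x => f x * (v x : ℂ)) p volume

/-- Membership in the weighted space `L_{p,v}`. -/
def MemWLp {d : ℕ} (f : E d → ℂ) (p : ℝ≥0∞) (v : E d → ℝ) : Prop :=
  MemLp (fun x => f x * (v x : ℂ)) p volume

/-- The norm `‖φ‖_{𝓛_p} = ‖∑_{k ∈ ℤ^d} |φ(· + k)|‖_{L_p(𝕋^d)}`, with value in `[0,∞]`. -/
def calNorm {d : ℕ} (φ : E d → ℂ) (p : ℝ≥0∞) : ℝ≥0∞ :=
  eLpNorm (fun x => ∑' k : Fin d → ℤ, ‖φ (x + latticePt k)‖ₑ) p (volume.restrict (unitCube d))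

/-- Membership in the space `𝓛_p`. -/
def MemCal {d : ℕ} (φ : E d → ℂ) (p : ℝ≥0∞) : Prop :=
  MemLp φ p volume ∧ calNorm φ p < ∞

/-- Membership in the weighted space `𝓛_{p,v}`, i.e. `φ v ∈ 𝓛_p`. -/
def MemWCal {d : ℕ} (φ : E d → ℂ) (p : ℝ≥0∞) (v : E d → ℝ) : Prop :=
  MemCal (fun x => φ x * (v x : ℂ)) p

/-- The function `F`, regarded up to null sets, is supported in `A`:
it vanishes almost everywhere outside `A`. -/
def SuppIn {d : ℕ} (F : E d → ℂ) (A : Set (E d)) : Prop :=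
  ∀ᵐ ξ, ξ ∉ A → F ξ = 0

/-- `g ∈ L_2` and its (Plancherel) Fourier transform is supported in `A`. -/
def BandLimited {d : ℕ} (g : E d → ℂ) (A : Set (E d)) : Prop :=
  ∃ hg : MemLp g 2 (volume : Measure (E d)), SuppIn (𝓕 (hg.toLp g) : Lp ℂ 2 volume) A

/-- The error of best approximation `E_A(f)_{p,v}` by functions `g ∈ L_{p,v} ∩ L_2` with
`supp ĝ ⊂ A`. -/
def bestApprox {d : ℕ} (A : Set (E d)) (f : E d → ℂ) (p : ℝ≥0∞) (v : E d → ℝ) : ℝ≥0∞ :=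
  ⨅ (g : E d → ℂ) (_ : MemWLp g p v ∧ BandLimited g A), wNorm (fun x => f x - g x) p v

/-- `φ_{jk}(x) = m^{j/2} φ(M^j x + k)`, where `m = |det M|`. -/
def dil {d : ℕ} (M : Matrix (Fin d) (Fin d) ℝ) (φ : E d → ℂ) (j : ℕ) (k : Fin d → ℤ) :
    E d → ℂ :=
  fun x => ((|M.det| ^ ((j : ℝ) / 2) : ℝ) : ℂ) * φ (act (M ^ j) x + latticePt k)

/-- `⟨f, g⟩ = ∫ f ḡ`. -/
def pairing {d : ℕ} (f g : E d → ℂ) : ℂ := ∫ x, f x * conj (g x)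

/-- The quasi-projection operator `Q_j f = ∑_{k ∈ ℤ^d} ⟨f, φ̃_{jk}⟩ φ_{jk}` (pointwise sum). -/
def quasiProj {d : ℕ} (M : Matrix (Fin d) (Fin d) ℝ) (φ φt : E d → ℂ) (j : ℕ)
    (f : E d → ℂ) : E d → ℂ :=
  fun x => ∑' k : Fin d → ℤ, pairing f (dil M φt j k) * dil M φ j k x

/-- Strict compatibility of `φ̃` and `φ` with respect to the parameter `δ` (for integrable
functions, so that both Fourier transforms are given by the Fourier integral). -/
def StrictlyCompatible {d : ℕ} (φ φt : E d → ℂ) (δ : ℝ) : Prop :=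
  ∀ᵐ ξ : E d, ‖ξ‖ < δ → conj (𝓕 φ ξ) * 𝓕 φt ξ = 1

end QuasiProj

end

noncomputable section

namespace QuasiProj

variable {d : ℕ}

/-! The estimate is a Lebesgue-type inequality. If `g` has its spectrum in `{|M^{*-j} ξ| < δ}` and
`Q_j g = g`, then `f - Q_j f = (f - g) - Q_j (f - g)`, so a bound for `Q_j` on `L_{p,1/w}` that is
uniform in `j` gives the claim after an infimum over `g` (`wNorm_sub_quasiProj_le`).

Both ingredients reduce to level zero: `Q_j` is `Q_0` conjugated by `x ↦ M^j x`
(`quasiProj_eq_levelZero`), at the price of replacing `w` by `w(M^{-j} ·)`. These weights are all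
moderate with respect to `ws` with one constant (`IsWeight.isModerate`), which is where uniformity
in `j` comes from.

Boundedness: moderateness moves the weight to the lattice point `-k`, where the factor produced by
the coefficient cancels the one needed by the synthesis (`tsum_enorm_mul_weight_le`). What remains
is an unweighted inequality for nonnegative functions, `eLpNorm_latticeSynth_latticeCorr_le`, proved
by Hölder's inequality against periodizations.

Reproduction: as `𝓕 φ` vanishes near the nonzero lattice points, Poisson summation gives `∑_k
e^{-2πi(k,ξ)} φ(x+k) = e^{2πi(x,ξ)} 𝓕 φ(ξ)` for `|ξ| < δ` (`ae_tsum_expChar_eq_fourier`). A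
band-limited `g` is, after rescaling, `𝓕⁻ H` with `H` integrable and supported in the ball;
integrating the identity against `H · conj (𝓕 φt)` and using strict compatibility returns `𝓕⁻ H`. -/

/-! ### Tiling of space by lattice translates of the cube. -/

@[simp] theorem latticePt_apply (k : Fin d → ℤ) (i : Fin d) : latticePt k i = (k i : ℝ) := rfl

theorem latticePt_add (k l : Fin d → ℤ) : latticePt (k + l) = latticePt k + latticePt l := by
  ext i; simp

theorem latticePt_neg (k : Fin d → ℤ) : latticePt (-k) = -latticePt k := by
  ext i; simp

/-- The half-open unit cube centred at the origin. -/
def halfOpenCube (d : ℕ) : Set (E d) := {x | ∀ i, x i ∈ Ico (-(1 / 2) : ℝ) (1 / 2)}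

theorem measurableSet_halfOpenCube : MeasurableSet (halfOpenCube d) := by
  have : halfOpenCube d = ⋂ i, (fun x : E d => x i) ⁻¹' Ico (-(1 / 2) : ℝ) (1 / 2) := by
    ext x; simp [halfOpenCube]
  rw [this]
  exact MeasurableSet.iInter fun i =>
    (by fun_prop : Measurable fun x : E d => x i) measurableSet_Ico

theorem ofLp_preimage_Icc : (WithLp.ofLp : E d → Fin d → ℝ) ⁻¹'
    (Icc (fun _ => -(1 / 2) : Fin d → ℝ) fun _ => 1 / 2) = unitCube d := by
  ext x; simp [unitCube, Pi.le_def, forall_and]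

theorem halfOpenCube_ae_eq_unitCube : halfOpenCube d =ᵐ[volume] unitCube d := by
  have h := (Measure.univ_pi_Ico_ae_eq_Icc (μ := fun _ : Fin d => (volume : Measure ℝ))
    (f := fun _ => -(1 / 2)) (g := fun _ => 1 / 2))
  rw [← volume_pi] at h
  have h2 := (PiLp.volume_preserving_ofLp (Fin d)).quasiMeasurePreserving.preimage_ae_eq h
  have e1 : (WithLp.ofLp : E d → Fin d → ℝ) ⁻¹' (Set.univ.pi fun _ => Ico (-(1 / 2) : ℝ) (1 / 2))
      = halfOpenCube d := by
    ext x; simp [halfOpenCube]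
  rwa [e1, ofLp_preimage_Icc] at h2

theorem restrict_unitCube :
    (volume : Measure (E d)).restrict (unitCube d) = volume.restrict (halfOpenCube d) :=
  (Measure.restrict_congr_set halfOpenCube_ae_eq_unitCube).symm

/-- Half-open sides make the representative modulo the lattice unique, so the translates tile
exactly and not just up to null sets. -/
theorem add_latticePt_mem_halfOpenCube_iff (x : E d) (k : Fin d → ℤ) :
    x + latticePt k ∈ halfOpenCube d ↔ k = fun i => -⌊x i + 1 / 2⌋ := by
  simp only [halfOpenCube, mem_ofPred_eq, PiLp.add_apply, latticePt_apply, mem_Ico, funext_iff]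
  refine forall_congr' fun i => ?_
  rw [eq_comm (a := k i), neg_eq_iff_eq_neg, Int.floor_eq_iff]
  push_cast
  constructor <;> rintro ⟨h1, h2⟩ <;> constructor <;> linarith

theorem isCompact_unitCube : IsCompact (unitCube d) := by
  refine Metric.isCompact_of_isClosed_isBounded ?_ ?_
  · have : unitCube d = ⋂ i, (fun x : E d => x i) ⁻¹' Icc (-(1 / 2) : ℝ) (1 / 2) := by
      ext x; simp [unitCube]
    rw [this]
    exact isClosed_iInter fun i => isClosed_Icc.preimage (by fun_prop)
  · refine (Metric.isBounded_closedBall (x := (0 : E d)) (r := √(d : ℝ))).subset fun x hx => ?_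
    rw [mem_closedBall_zero_iff, EuclideanSpace.norm_eq]
    refine Real.sqrt_le_sqrt ?_
    calc ∑ i, ‖x i‖ ^ 2 ≤ ∑ i : Fin d, (1 : ℝ) := by
          refine Finset.sum_le_sum fun i _ => ?_
          have := hx i
          rw [Real.norm_eq_abs, sq_abs]
          nlinarith [this.1, this.2]
      _ = d := by simp

theorem volume_halfOpenCube_lt_top : volume (halfOpenCube d) < ∞ := by
  rw [measure_congr halfOpenCube_ae_eq_unitCube]
  exact isCompact_unitCube.measure_lt_top

instance : IsFiniteMeasure ((volume : Measure (E d)).restrict (halfOpenCube d)) :=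
  ⟨by simpa using volume_halfOpenCube_lt_top⟩

/-- The translate of the half-open cube by `-k`. -/
def shiftedCube (k : Fin d → ℤ) : Set (E d) := (fun x => x + latticePt k) ⁻¹' halfOpenCube d

theorem measurableSet_shiftedCube (k : Fin d → ℤ) : MeasurableSet (shiftedCube k) :=
  (by fun_prop : Measurable fun x : E d => x + latticePt k) measurableSet_halfOpenCube

theorem iUnion_shiftedCube : ⋃ k : Fin d → ℤ, shiftedCube k = univ := by
  exact eq_univ_of_forall fun x => mem_iUnion.2
    ⟨fun i => -⌊x i + 1 / 2⌋, (add_latticePt_mem_halfOpenCube_iff x _).2 rfl⟩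

theorem pairwise_disjoint_shiftedCube :
    Pairwise (Function.onFun Disjoint (shiftedCube (d := d))) := by
  intro k l hkl
  refine Set.disjoint_left.2 fun x hk hl => hkl ?_
  rw [(add_latticePt_mem_halfOpenCube_iff x k).1 hk, (add_latticePt_mem_halfOpenCube_iff x l).1 hl]

theorem measurePreserving_restrict_shiftedCube (k : Fin d → ℤ) :
    MeasurePreserving (fun x : E d => x + latticePt k) (volume.restrict (shiftedCube k))
      (volume.restrict (halfOpenCube d)) :=
  (measurePreserving_add_right volume (latticePt k)).restrict_preimage measurableSet_halfOpenCube

/-- A property that is invariant under lattice shifts and holds almost everywhere on the cube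
holds almost everywhere. -/
theorem ae_of_ae_restrict_halfOpenCube {P : E d → Prop}
    (hP : ∀ x (k : Fin d → ℤ), P (x + latticePt k) → P x)
    (h : ∀ᵐ x ∂volume.restrict (halfOpenCube d), P x) : ∀ᵐ x, P x := by
  have h1 : ∀ k : Fin d → ℤ, ∀ᵐ x ∂volume.restrict (shiftedCube k), P x := fun k => by
    have := (measurePreserving_restrict_shiftedCube k).quasiMeasurePreserving.ae h
    filter_upwards [this] with x hx using hP x k hx
  have := ae_restrict_iUnion_iff (μ := volume) (fun k : Fin d → ℤ => shiftedCube k) P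
  rw [iUnion_shiftedCube, Measure.restrict_univ] at this
  exact this.2 h1

/-! ### Integrals over space as integrals of periodizations. -/

theorem aemeasurable_comp_add_right {β : Type*} [MeasurableSpace β] {f : E d → β}
    (hf : AEMeasurable f) (t : E d) : AEMeasurable fun x => f (x + t) :=
  hf.comp_quasiMeasurePreserving (measurePreserving_add_right volume t).quasiMeasurePreserving

theorem lintegral_eq_tsum_cube (f : E d → ℝ≥0∞) :
    ∫⁻ x, f x = ∑' k : Fin d → ℤ, ∫⁻ x in halfOpenCube d, f (x + latticePt k) := by
  rw [← setLIntegral_univ, ← iUnion_shiftedCube,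
    lintegral_iUnion measurableSet_shiftedCube pairwise_disjoint_shiftedCube]
  -- The tile with index `k` is the cube moved by `-k`, hence the change of sign in the summation
  -- index.
  rw [← (Equiv.neg (Fin d → ℤ)).tsum_eq]
  refine tsum_congr fun k => ?_
  rw [← (measurePreserving_restrict_shiftedCube (-k)).lintegral_comp_emb
    (MeasurableEquiv.addRight (latticePt (-k))).measurableEmbedding]
  simp [latticePt_neg]

/-- Integration over the space is integration of the periodization over the cube. -/
theorem lintegral_eq_lintegral_cube {f : E d → ℝ≥0∞} (hf : AEMeasurable f) :
    ∫⁻ x, f x = ∫⁻ x in halfOpenCube d, ∑' k : Fin d → ℤ, f (x + latticePt k) := by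
  rw [lintegral_eq_tsum_cube, lintegral_tsum]
  exact fun k => (aemeasurable_comp_add_right hf _).restrict

theorem integral_eq_tsum_cube {f : E d → ℂ} (hf : Integrable f) :
    ∫ x, f x = ∑' k : Fin d → ℤ, ∫ x in halfOpenCube d, f (x + latticePt k) := by
  rw [← setIntegral_univ, ← iUnion_shiftedCube,
    integral_iUnion measurableSet_shiftedCube pairwise_disjoint_shiftedCube hf.integrableOn]
  rw [← (Equiv.neg (Fin d → ℤ)).tsum_eq]
  refine tsum_congr fun k => ?_
  rw [← (measurePreserving_restrict_shiftedCube (-k)).integral_comp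
    (MeasurableEquiv.addRight (latticePt (-k))).measurableEmbedding]
  simp [latticePt_neg]

theorem lintegral_cube_tsum_enorm_lt_top {f : E d → ℂ} (hf : Integrable f) :
    ∫⁻ x in halfOpenCube d, ∑' k : Fin d → ℤ, ‖f (x + latticePt k)‖ₑ < ∞ := by
  rw [← lintegral_eq_lintegral_cube hf.1.enorm]
  exact hf.2

theorem integral_eq_integral_cube {f : E d → ℂ} (hf : Integrable f) :
    ∫ x, f x = ∫ x in halfOpenCube d, ∑' k : Fin d → ℤ, f (x + latticePt k) := by
  rw [integral_eq_tsum_cube hf, integral_tsum]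
  · exact fun k => ((hf.comp_add_right _).1).restrict
  · rw [← lintegral_tsum fun k => ((hf.comp_add_right _).1).restrict.enorm]
    exact (lintegral_cube_tsum_enorm_lt_top hf).ne

theorem ae_tsum_enorm_lt_top {f : E d → ℂ} (hf : Integrable f) :
    ∀ᵐ x, ∑' k : Fin d → ℤ, ‖f (x + latticePt k)‖ₑ < ∞ := by
  refine ae_of_ae_restrict_halfOpenCube (fun x k h => ?_) ?_
  · rw [← (Equiv.addLeft k).tsum_eq]
    simpa [latticePt_add, add_assoc] using h
  · exact ae_lt_top' (AEMeasurable.tsum fun k => ((hf.comp_add_right _).1).restrict.enorm)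
      (lintegral_cube_tsum_enorm_lt_top hf).ne

theorem ae_summable_comp_add {f : E d → ℂ} (hf : Integrable f) :
    ∀ᵐ x, Summable fun k : Fin d → ℤ => ‖f (x + latticePt k)‖ := by
  filter_upwards [ae_tsum_enorm_lt_top hf] with x hx
  exact tsum_enorm_ne_top_iff_summable_norm.1 hx.ne

theorem integrableOn_cube_tsum {f : E d → ℂ} (hf : Integrable f) :
    IntegrableOn (fun x => ∑' k : Fin d → ℤ, f (x + latticePt k)) (halfOpenCube d) := by
  refine ⟨?_, ?_⟩
  · exact (AEMeasurable.tsum fun k =>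
      ((hf.comp_add_right _).1).restrict.aemeasurable).aestronglyMeasurable
  · refine lt_of_le_of_lt (lintegral_mono fun x => ?_) (lintegral_cube_tsum_enorm_lt_top hf)
    exact enorm_tsum_le_tsum_enorm

/-- The periodization `∑_{k ∈ ℤ^d} ψ(· + k)` of a nonnegative function. -/
def periodize (ψ : E d → ℝ≥0∞) (x : E d) : ℝ≥0∞ := ∑' k : Fin d → ℤ, ψ (x + latticePt k)

theorem periodize_add (ψ : E d → ℝ≥0∞) (x : E d) (k : Fin d → ℤ) :
    periodize ψ (x + latticePt k) = periodize ψ x := by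
  rw [periodize, periodize, ← (Equiv.addLeft k).tsum_eq (fun l => ψ (x + latticePt l))]
  simp [latticePt_add, add_assoc]

theorem aemeasurable_periodize {ψ : E d → ℝ≥0∞} (hψ : AEMeasurable ψ) :
    AEMeasurable (periodize ψ) :=
  AEMeasurable.tsum fun k => aemeasurable_comp_add_right hψ (latticePt k)

theorem lintegral_eq_lintegral_periodize {ψ : E d → ℝ≥0∞} (hψ : AEMeasurable ψ) :
    ∫⁻ x, ψ x = ∫⁻ x in halfOpenCube d, periodize ψ x :=
  lintegral_eq_lintegral_cube hψ

/-! ### Analysis and synthesis inequalities for lattice sums. -/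

/-- A weighted form of Jensen's inequality. -/
theorem lintegral_mul_rpow_le {α : Type*} [MeasurableSpace α] {μ : Measure α} {r s : ℝ}
    (hrs : r.HolderConjugate s) {g ω : α → ℝ≥0∞} (hg : AEMeasurable g μ) (hω : AEMeasurable ω μ) :
    (∫⁻ a, g a * ω a ∂μ) ^ r ≤ (∫⁻ a, g a ^ r * ω a ∂μ) * (∫⁻ a, ω a ∂μ) ^ (r - 1) := by
  -- Hölder for the splitting `g ω = (g ω^{1/r}) · ω^{1/s}`.
  have h := ENNReal.lintegral_mul_le_Lp_mul_Lq μ hrs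
    (f := fun a => g a * ω a ^ (1 / r)) (g := fun a => ω a ^ (1 / s)) (by fun_prop) (by fun_prop)
  have hr := hrs.pos
  have hs := hrs.symm.pos
  have e1 : ∀ a, ((fun a => g a * ω a ^ (1 / r)) * fun a => ω a ^ (1 / s)) a = g a * ω a := by
    intro a
    rw [Pi.mul_apply, mul_assoc, ← ENNReal.rpow_add_of_nonneg _ _ (by positivity) (by positivity)]
    rw [one_div, one_div, hrs.inv_add_inv_eq_one, ENNReal.rpow_one]
  have e2 : ∀ a, (g a * ω a ^ (1 / r)) ^ r = g a ^ r * ω a := by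
    intro a
    rw [ENNReal.mul_rpow_of_nonneg _ _ hr.le, ← ENNReal.rpow_mul, one_div_mul_cancel hr.ne',
      ENNReal.rpow_one]
  have e3 : ∀ a, (ω a ^ (1 / s)) ^ s = ω a := by
    intro a
    rw [← ENNReal.rpow_mul, one_div_mul_cancel hs.ne', ENNReal.rpow_one]
  simp only [e1, e2, e3] at h
  refine (ENNReal.rpow_le_rpow h hr.le).trans_eq ?_
  rw [ENNReal.mul_rpow_of_nonneg _ _ hr.le, ← ENNReal.rpow_mul, one_div_mul_cancel hr.ne',
    ENNReal.rpow_one, ← ENNReal.rpow_mul]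
  congr 2
  rw [← hrs.div_conj_eq_sub_one]; ring

/-- The weighted Jensen inequality for counting measure. -/
theorem tsum_mul_rpow_le {ι : Type*} {r s : ℝ} (hrs : r.HolderConjugate s) (g ω : ι → ℝ≥0∞) :
    (∑' i, g i * ω i) ^ r ≤ (∑' i, g i ^ r * ω i) * (∑' i, ω i) ^ (r - 1) := by
  let _ : MeasurableSpace ι := ⊤
  have h := lintegral_mul_rpow_le (μ := Measure.count) hrs (g := g) (ω := ω)
    (measurable_from_top.aemeasurable) (measurable_from_top.aemeasurable)
  simpa [lintegral_count] using h

/-- The lattice samples of the correlation of `b` with `ψ`. -/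
def latticeCorr (b ψ : E d → ℝ≥0∞) (k : Fin d → ℤ) : ℝ≥0∞ := ∫⁻ y, b y * ψ (y + latticePt k)

/-- The series `∑_k B_k ψ(· + k)`. -/
def latticeSynth (B : (Fin d → ℤ) → ℝ≥0∞) (ψ : E d → ℝ≥0∞) (x : E d) : ℝ≥0∞ :=
  ∑' k, B k * ψ (x + latticePt k)

theorem mul_rpow_sub_one {r : ℝ} (hr : 1 < r) (a : ℝ≥0∞) : a * a ^ (r - 1) = a ^ r := by
  nth_rw 1 [← ENNReal.rpow_one a]
  rw [← ENNReal.rpow_add_of_nonneg _ _ zero_le_one (by linarith)]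
  congr 1; ring

/-- The periodization is invariant under lattice shifts, so the shift by `k` drops out; folding onto
the cube then turns the factor `ψ` into one more `periodize ψ`. The independence of `k` is what both
inequalities below rely on. -/
theorem lintegral_shift_mul_periodize {ψ : E d → ℝ≥0∞} (hψ : AEMeasurable ψ) {r : ℝ} (hr : 1 < r)
    (k : Fin d → ℤ) :
    ∫⁻ x, ψ (x + latticePt k) * periodize ψ x ^ (r - 1) =
      ∫⁻ x in halfOpenCube d, periodize ψ x ^ r := by
  have h1 : ∫⁻ x, ψ (x + latticePt k) * periodize ψ x ^ (r - 1) =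
      ∫⁻ x, ψ x * periodize ψ x ^ (r - 1) := by
    rw [← lintegral_add_right_eq_self (fun x => ψ x * periodize ψ x ^ (r - 1)) (latticePt k)]
    simp only [periodize_add]
  have h2 : AEMeasurable fun x => ψ x * periodize ψ x ^ (r - 1) :=
    hψ.mul ((aemeasurable_periodize hψ).pow_const _)
  rw [h1, lintegral_eq_lintegral_cube h2]
  simp only [periodize_add, ENNReal.tsum_mul_right]
  exact lintegral_congr fun x => mul_rpow_sub_one hr _

/-- Jensen at each `x` with the weights `ψ (x + k)`, whose total mass is `periodize ψ x`, followed
by integration term by term. -/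
theorem lintegral_latticeSynth_rpow_le {r s : ℝ} (hrs : r.HolderConjugate s)
    (B : (Fin d → ℤ) → ℝ≥0∞) {ψ : E d → ℝ≥0∞} (hψ : AEMeasurable ψ) :
    ∫⁻ x, latticeSynth B ψ x ^ r ≤
      (∑' k, B k ^ r) * ∫⁻ x in halfOpenCube d, periodize ψ x ^ r := by
  have hm : ∀ k : Fin d → ℤ, AEMeasurable fun x => ψ (x + latticePt k) * periodize ψ x ^ (r - 1) :=
    fun k => (aemeasurable_comp_add_right hψ _).mul ((aemeasurable_periodize hψ).pow_const _)
  calc ∫⁻ x, latticeSynth B ψ x ^ r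
      ≤ ∫⁻ x, ∑' k, B k ^ r * (ψ (x + latticePt k) * periodize ψ x ^ (r - 1)) := by
        refine lintegral_mono fun x => ?_
        simp only [← mul_assoc, ENNReal.tsum_mul_right]
        exact tsum_mul_rpow_le hrs B fun k => ψ (x + latticePt k)
    _ = (∑' k, B k ^ r) * ∫⁻ x in halfOpenCube d, periodize ψ x ^ r := by
        rw [lintegral_tsum fun k => (hm k).const_mul _, ← ENNReal.tsum_mul_right]
        refine tsum_congr fun k => ?_
        rw [lintegral_const_mul'' _ (hm k), lintegral_shift_mul_periodize hψ hrs.lt]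

/-- With `S = periodize ψ` and `ψ_k = ψ(· + k)`, Hölder is applied to `ψ_k = (ψ_k / S)^{1/r} · (ψ_k
S^{s-1})^{1/s}`. The second factor contributes the same constant for every `k`, and the weights `ψ_k
/ S` of the first sum to at most `1`. -/
theorem tsum_latticeCorr_rpow_le {r s : ℝ} (hrs : r.HolderConjugate s)
    {b ψ : E d → ℝ≥0∞} (hb : AEMeasurable b) (hψ : AEMeasurable ψ)
    (hfin : ∀ᵐ x, periodize ψ x < ∞) :
    ∑' k, latticeCorr b ψ k ^ r ≤
      (∫⁻ x, b x ^ r) * (∫⁻ x in halfOpenCube d, periodize ψ x ^ s) ^ (r / s) := by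
  have hr := hrs.pos
  have hs := hrs.symm.pos
  have hS := aemeasurable_periodize hψ
  have hψk : ∀ k : Fin d → ℤ, AEMeasurable fun x => ψ (x + latticePt k) :=
    fun k => aemeasurable_comp_add_right hψ _
  have key : ∀ k, latticeCorr b ψ k ^ r ≤
      (∫⁻ x, b x ^ r * ((periodize ψ x)⁻¹ * ψ (x + latticePt k))) *
        (∫⁻ x in halfOpenCube d, periodize ψ x ^ s) ^ (r / s) := by
    intro k
    have h := ENNReal.lintegral_mul_le_Lp_mul_Lq volume hrs
      (f := fun x => b x * ((periodize ψ x)⁻¹ * ψ (x + latticePt k)) ^ (1 / r))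
      (g := fun x => (ψ (x + latticePt k) * periodize ψ x ^ (s - 1)) ^ (1 / s))
      (hb.mul ((hS.inv.mul (hψk k)).pow_const _)) (((hψk k).mul (hS.pow_const _)).pow_const _)
    have e2 : ∀ x, (b x * ((periodize ψ x)⁻¹ * ψ (x + latticePt k)) ^ (1 / r)) ^ r =
        b x ^ r * ((periodize ψ x)⁻¹ * ψ (x + latticePt k)) := by
      intro x
      rw [ENNReal.mul_rpow_of_nonneg _ _ hr.le, ← ENNReal.rpow_mul, one_div_mul_cancel hr.ne',
        ENNReal.rpow_one]
    have e3 : ∀ x, ((ψ (x + latticePt k) * periodize ψ x ^ (s - 1)) ^ (1 / s)) ^ s =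
        ψ (x + latticePt k) * periodize ψ x ^ (s - 1) := by
      intro x
      rw [← ENNReal.rpow_mul, one_div_mul_cancel hs.ne', ENNReal.rpow_one]
    simp only [e2, e3, lintegral_shift_mul_periodize hψ hrs.symm.lt] at h
    have hle : latticeCorr b ψ k ≤ ∫⁻ x, ((fun x => b x *
        ((periodize ψ x)⁻¹ * ψ (x + latticePt k)) ^ (1 / r)) *
        fun x => (ψ (x + latticePt k) * periodize ψ x ^ (s - 1)) ^ (1 / s)) x := by
      refine lintegral_mono_ae ?_
      filter_upwards [hfin] with x hx
      rw [Pi.mul_apply, mul_assoc]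
      gcongr
      -- The splitting divides by `S`: where `ψ_k` vanishes there is nothing to prove, and elsewhere
      -- `S` is nonzero and, by `hfin`, finite.
      rcases eq_or_ne (ψ (x + latticePt k)) 0 with h0 | h0
      · simp [h0]
      have hS0 : periodize ψ x ≠ 0 := fun hz => h0 (ENNReal.tsum_eq_zero.1 hz k)
      rw [ENNReal.mul_rpow_of_nonneg _ _ (by positivity),
        ENNReal.mul_rpow_of_nonneg _ _ (by positivity),
        mul_comm ((periodize ψ x)⁻¹ ^ (1 / r)), mul_mul_mul_comm, ← ENNReal.rpow_add _ _ h0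
          (ne_top_of_le_ne_top hx.ne (ENNReal.le_tsum k)), ← ENNReal.rpow_mul]
      have h1 : (s - 1) * (1 / s) = 1 / r := by
        rw [← hrs.symm.div_conj_eq_sub_one]; field_simp
      rw [h1, one_div, one_div, hrs.inv_add_inv_eq_one, ENNReal.rpow_one, ENNReal.inv_rpow,
        mul_comm (_ ^ r⁻¹)⁻¹, ENNReal.mul_inv_cancel (by simp [hS0, hx.ne])
          (by simp [hS0, hx.ne]), mul_one]
    refine (ENNReal.rpow_le_rpow (hle.trans h) hr.le).trans_eq ?_
    rw [ENNReal.mul_rpow_of_nonneg _ _ hr.le, ← ENNReal.rpow_mul, one_div_mul_cancel hr.ne',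
      ENNReal.rpow_one, ← ENNReal.rpow_mul]
    congr 2
    ring
  refine (ENNReal.tsum_le_tsum key).trans ?_
  rw [ENNReal.tsum_mul_right]
  gcongr
  have hm : ∀ k : Fin d → ℤ,
      AEMeasurable fun x => b x ^ r * ((periodize ψ x)⁻¹ * ψ (x + latticePt k)) :=
    fun k => (hb.pow_const _).mul (hS.inv.mul (hψk k))
  rw [← lintegral_tsum hm]
  refine lintegral_mono fun x => ?_
  simp only [ENNReal.tsum_mul_left]
  calc b x ^ r * ((periodize ψ x)⁻¹ * periodize ψ x) ≤ b x ^ r * 1 := by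
        gcongr; exact ENNReal.inv_mul_le_one _
    _ = _ := mul_one _

/-- By periodicity, the essential supremum over the cube bounds the function on all of space. -/
theorem ae_le_eLpNorm_top_periodize {ψ : E d → ℝ≥0∞} :
    ∀ᵐ x, periodize ψ x ≤ eLpNorm (periodize ψ) ∞ (volume.restrict (halfOpenCube d)) := by
  refine ae_of_ae_restrict_halfOpenCube (fun x k h => by rwa [periodize_add] at h) ?_
  simpa using (enorm_ae_le_eLpNormEssSup (periodize ψ) (volume.restrict (halfOpenCube d)))

theorem eLpNorm_ennreal_eq_lintegral {α : Type*} [MeasurableSpace α] {μ : Measure α} {p : ℝ≥0∞}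
    (hp0 : p ≠ 0) (hp : p ≠ ∞) (f : α → ℝ≥0∞) :
    eLpNorm f p μ = (∫⁻ x, f x ^ p.toReal ∂μ) ^ (1 / p.toReal) := by
  simp [eLpNorm_eq_lintegral_rpow_enorm_toReal hp0 hp]

/-- The cube has finite measure, so `L_p` of the cube embeds in `L_1`. -/
theorem lintegral_periodize_lt_top {p : ℝ≥0∞} (hp : 1 ≤ p) {ψ : E d → ℝ≥0∞} (hψ : AEMeasurable ψ)
    (hfin : eLpNorm (periodize ψ) p (volume.restrict (halfOpenCube d)) < ∞) :
    ∫⁻ x in halfOpenCube d, periodize ψ x < ∞ := by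
  have hm := (aemeasurable_periodize hψ).restrict (s := halfOpenCube d)
  have := eLpNorm_le_eLpNorm_mul_rpow_measure_univ hp hm.aestronglyMeasurable
  rw [eLpNorm_one_eq_lintegral_enorm] at this
  refine lt_of_le_of_lt (by simpa using this) (ENNReal.mul_lt_top hfin ?_)
  refine ENNReal.rpow_lt_top_of_nonneg ?_ volume_halfOpenCube_lt_top.ne
  rcases eq_or_ne p ∞ with rfl | hp'
  · simp
  · have : 1 ≤ p.toReal := by
      rw [← ENNReal.toReal_one]; exact ENNReal.toReal_mono hp' hp
    simpa using inv_le_one_of_one_le₀ this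

/-- The basic convolution-type inequality in the amalgam spaces. -/
theorem eLpNorm_latticeSynth_latticeCorr_le {p q : ℝ≥0∞} (hp : 1 ≤ p) (hpq : 1 / p + 1 / q = 1)
    {b ψt ψ : E d → ℝ≥0∞} (hb : AEMeasurable b) (hψt : AEMeasurable ψt) (hψ : AEMeasurable ψ)
    (hfin : eLpNorm (periodize ψt) q (volume.restrict (halfOpenCube d)) < ∞) :
    eLpNorm (latticeSynth (latticeCorr b ψt) ψ) p volume ≤
      eLpNorm b p volume * eLpNorm (periodize ψt) q (volume.restrict (halfOpenCube d)) *
        eLpNorm (periodize ψ) p (volume.restrict (halfOpenCube d)) := by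
  have hψtk : ∀ k : Fin d → ℤ, AEMeasurable fun x => ψt (x + latticePt k) :=
    fun k => aemeasurable_comp_add_right hψt _
  have hψk : ∀ k : Fin d → ℤ, AEMeasurable fun x => ψ (x + latticePt k) :=
    fun k => aemeasurable_comp_add_right hψ _
  -- The endpoints `p = 1` and `p = ∞` are bounded directly, because real conjugate exponents
  -- exclude them.
  rcases eq_or_ne p 1 with rfl | hp1
  · obtain rfl : q = ∞ := by
      have : (1 : ℝ≥0∞) + 1 / q = 1 + 0 := by simpa using hpq
      simpa using (ENNReal.add_right_inj ENNReal.one_ne_top).1 this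
    simp only [eLpNorm_one_eq_lintegral_enorm, enorm_eq_self]
    have h1 : ∑' k, latticeCorr b ψt k ≤ (∫⁻ x, b x) *
        eLpNorm (periodize ψt) ∞ (volume.restrict (halfOpenCube d)) := by
      unfold latticeCorr
      have hm : ∀ k : Fin d → ℤ, AEMeasurable fun x => b x * ψt (x + latticePt k) :=
        fun k => hb.mul (hψtk k)
      rw [← lintegral_tsum hm]
      simp only [ENNReal.tsum_mul_left]
      refine (lintegral_mono_ae ?_).trans_eq (lintegral_mul_const'' _ hb)
      filter_upwards [ae_le_eLpNorm_top_periodize (ψ := ψt)] with x hx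
      gcongr
      exact hx
    unfold latticeSynth
    rw [lintegral_tsum fun k => (hψk k).const_mul _, ← lintegral_eq_lintegral_periodize hψ]
    simp only [lintegral_const_mul'' _ (hψk _), lintegral_add_right_eq_self, ENNReal.tsum_mul_right]
    gcongr
  rcases eq_or_ne p ∞ with rfl | hpt
  · obtain rfl : q = 1 := by simpa [ENNReal.inv_eq_one] using hpq
    have h1 : ∀ k, latticeCorr b ψt k ≤ eLpNorm b ∞ volume *
        eLpNorm (periodize ψt) 1 (volume.restrict (halfOpenCube d)) := by
      intro k
      rw [eLpNorm_one_eq_lintegral_enorm]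
      simp only [enorm_eq_self]
      rw [← lintegral_eq_lintegral_periodize hψt, ← lintegral_add_right_eq_self ψt (latticePt k),
        ← lintegral_const_mul'' _ (hψtk k)]
      refine lintegral_mono_ae ?_
      filter_upwards [enorm_ae_le_eLpNormEssSup b volume] with x hx
      gcongr
      simpa using hx
    rw [eLpNorm_exponent_top (f := latticeSynth _ _)]
    refine essSup_le_of_ae_le _ ?_
    filter_upwards [ae_le_eLpNorm_top_periodize (ψ := ψ)] with x hx
    rw [enorm_eq_self]
    calc latticeSynth (latticeCorr b ψt) ψ x
        ≤ ∑' k : Fin d → ℤ, (eLpNorm b ∞ volume *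
          eLpNorm (periodize ψt) 1 (volume.restrict (halfOpenCube d))) * ψ (x + latticePt k) :=
          ENNReal.tsum_le_tsum fun k => by gcongr; exact h1 k
      _ = _ := ENNReal.tsum_mul_left
      _ ≤ _ := by gcongr; exact hx
  · have hp0 : p ≠ 0 := (zero_lt_one.trans_le hp).ne'
    have hq0 : q ≠ 0 := by rintro rfl; simp at hpq
    have hqt : q ≠ ∞ := by rintro rfl; exact hp1 (by simpa [ENNReal.inv_eq_one] using hpq)
    have hr1 : 1 < p.toReal := by
      rw [← ENNReal.toReal_one]
      exact ENNReal.toReal_strict_mono hpt (lt_of_le_of_ne hp hp1.symm)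
    have hrs : p.toReal.HolderConjugate q.toReal := by
      refine Real.holderConjugate_iff.2 ⟨hr1, ?_⟩
      have := congrArg ENNReal.toReal hpq
      rw [ENNReal.toReal_add (by simp [hp0]) (by simp [hq0])] at this
      simpa using this
    have hr := hrs.pos
    have hfin' : ∀ᵐ x, periodize ψt x < ∞ := by
      refine ae_of_ae_restrict_halfOpenCube (fun x k h => by rwa [periodize_add] at h) ?_
      refine ae_lt_top' (aemeasurable_periodize hψt).restrict ?_
      refine (lintegral_periodize_lt_top (p := q) ?_ hψt hfin).ne
      rw [← ENNReal.inv_le_one]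
      calc q⁻¹ ≤ 1 / p + 1 / q := by simp
        _ = 1 := hpq
    rw [eLpNorm_ennreal_eq_lintegral hp0 hpt, eLpNorm_ennreal_eq_lintegral hp0 hpt,
      eLpNorm_ennreal_eq_lintegral hp0 hpt, eLpNorm_ennreal_eq_lintegral hq0 hqt]
    -- Synthesis is bounded by the `ℓ_p` norm of the coefficients, and that norm by the analysis
    -- inequality.
    have h := (lintegral_latticeSynth_rpow_le hrs (latticeCorr b ψt) hψ).trans
      (mul_le_mul_left (tsum_latticeCorr_rpow_le hrs hb hψt hfin') _)
    refine (ENNReal.rpow_le_rpow h (by positivity : 0 ≤ 1 / p.toReal)).trans_eq ?_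
    rw [ENNReal.mul_rpow_of_nonneg _ _ (by positivity),
      ENNReal.mul_rpow_of_nonneg _ _ (by positivity), ← ENNReal.rpow_mul _ (_ / _)]
    congr 3
    field_simp

/-! ### Fourier coefficients on the torus and constant periodizations. -/

/-- The quotient map `ℝ^d → ℝ^d / ℤ^d`. -/
def torusMk (x : E d) : UnitAddTorus (Fin d) := fun i => (x i : UnitAddCircle)

theorem continuous_torusMk : Continuous (torusMk (d := d)) := by
  unfold torusMk
  exact continuous_pi fun i => (AddCircle.continuous_mk' 1).comp (by fun_prop)

theorem torusMk_add_latticePt (x : E d) (k : Fin d → ℤ) :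
    torusMk (x + latticePt k) = torusMk x := by
  ext i
  simp [torusMk]

theorem mFourier_torusMk (n : Fin d → ℤ) (x : E d) :
    UnitAddTorus.mFourier n (torusMk x) = (Real.fourierChar (inner ℝ x (latticePt n)) : ℂ) := by
  rw [PiLp.inner_apply, Real.fourierChar_apply]
  simp only [UnitAddTorus.mFourier, ContinuousMap.coe_mk, torusMk, fourier_coe_apply]
  rw [← Complex.exp_sum]
  congr 1
  simp only [latticePt_apply, RCLike.inner_apply, conj_trivial]
  push_cast
  rw [Finset.mul_sum, Finset.sum_mul]
  exact Finset.sum_congr rfl fun i _ => by ring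

theorem norm_mFourier_torusMk_le (n : Fin d → ℤ) (x : E d) :
    ‖UnitAddTorus.mFourier n (torusMk x)‖ ≤ 1 := by
  rw [mFourier_torusMk]; exact (Circle.norm_coe _).le

theorem ae_mem_Ioo_of_mem_unitCube :
    ∀ᵐ x : E d, x ∈ unitCube d → ∀ i, x i ∈ Ioo (-(1 / 2) : ℝ) (1 / 2) := by
  have h := (Measure.univ_pi_Ioo_ae_eq_Icc (μ := fun _ : Fin d => (volume : Measure ℝ))
    (f := fun _ => -(1 / 2)) (g := fun _ => 1 / 2))
  rw [← volume_pi] at h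
  have h2 := (PiLp.volume_preserving_ofLp (Fin d)).quasiMeasurePreserving.preimage_ae_eq h
  filter_upwards [h2.mem_iff] with x hx hxc
  have h3 : x ∈ (WithLp.ofLp : E d → Fin d → ℝ) ⁻¹'
      (Icc (fun _ => -(1 / 2) : Fin d → ℝ) fun _ => 1 / 2) :=
    ⟨fun i => (hxc i).1, fun i => (hxc i).2⟩
  exact fun i => hx.2 h3 i (mem_univ i)

/-- Coordinates differ by integers, and openness of the interval for `x` excludes `±1`. Hence the
closed cube embeds in the torus apart from its faces, a null set. -/
theorem eq_of_torusMk_eq {x y : E d} (hx : ∀ i, x i ∈ Ioo (-(1 / 2) : ℝ) (1 / 2))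
    (hy : y ∈ unitCube d) (h : torusMk x = torusMk y) : x = y := by
  ext i
  have h0 : ((x i - y i : ℝ) : UnitAddCircle) = 0 := by
    have := congrFun h i
    simp only [torusMk] at this
    rw [AddCircle.coe_sub, this, sub_self]
  obtain ⟨n, hn⟩ := (AddCircle.coe_eq_zero_iff 1).1 h0
  have hn' : (n : ℝ) = x i - y i := by simpa using hn
  have h1 : (n : ℝ) < 1 := by have := (hx i).2; have := (hy i).1; linarith
  have h2 : (-1 : ℝ) < n := by have := (hx i).1; have := (hy i).2; linarith
  have : n = 0 := by
    have a : n < 1 := by exact_mod_cast h1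
    have b : -1 < n := by exact_mod_cast h2
    omega
  rw [this] at hn'
  simp only [Int.cast_zero] at hn'
  linarith

instance : IsFiniteMeasure ((volume : Measure (E d)).restrict (unitCube d)) :=
  ⟨by simpa using isCompact_unitCube.measure_lt_top⟩

/-- Integration against `Φ` is a continuous functional on `C(UnitAddTorus (Fin d), ℂ)`, and
trigonometric polynomials are dense there. -/
theorem integral_mul_torus_eq_zero {Φ : E d → ℂ} {μ : Measure (E d)} (hΦ : Integrable Φ μ)
    (h : ∀ n : Fin d → ℤ, ∫ x, Φ x * UnitAddTorus.mFourier n (torusMk x) ∂μ = 0)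
    (G : C(UnitAddTorus (Fin d), ℂ)) : ∫ x, Φ x * G (torusMk x) ∂μ = 0 := by
  have hint : ∀ G : C(UnitAddTorus (Fin d), ℂ), Integrable (fun x => Φ x * G (torusMk x)) μ :=
    fun G => hΦ.mul_bdd (c := ‖G‖) (G.continuous.comp continuous_torusMk).aestronglyMeasurable
      (Filter.Eventually.of_forall fun x => G.norm_coe_le_norm _)
  let L : C(UnitAddTorus (Fin d), ℂ) →ₗ[ℂ] ℂ :=
    { toFun := fun G => ∫ x, Φ x * G (torusMk x) ∂μ
      map_add' := fun G₁ G₂ => by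
        rw [← integral_add (hint _) (hint _)]
        simp [mul_add]
      map_smul' := fun c G => by
        rw [RingHom.id_apply, ← integral_smul]
        refine integral_congr_ae (Filter.Eventually.of_forall fun x => ?_)
        simp only [ContinuousMap.smul_apply, smul_eq_mul]; ring }
  let Lc : C(UnitAddTorus (Fin d), ℂ) →L[ℂ] ℂ := L.mkContinuous (∫ x, ‖Φ x‖ ∂μ) fun G => by
    rw [← integral_mul_const]
    refine norm_integral_le_of_norm_le (hΦ.norm.mul_const _)
      (Filter.Eventually.of_forall fun x => ?_)
    rw [norm_mul]
    gcongr
    exact G.norm_coe_le_norm _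
  have hle : (Submodule.span ℂ (range <| UnitAddTorus.mFourier (d := Fin d))).topologicalClosure ≤
      Lc.ker := by
    refine Submodule.topologicalClosure_minimal _ ?_ Lc.isClosed_ker
    rw [Submodule.span_le]
    rintro _ ⟨n, rfl⟩
    exact h n
  rw [UnitAddTorus.span_mFourier_closure_eq_top] at hle
  exact hle (Submodule.mem_top (x := G))

/-- The indicator of a closed set is the pointwise limit of continuous thickened indicators bounded
by `1`; dominated convergence passes from continuous functions to it. -/
theorem integral_torus_indicator_eq_zero {Φ : E d → ℂ} {μ : Measure (E d)} (hΦ : Integrable Φ μ)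
    (h : ∀ n : Fin d → ℤ, ∫ x, Φ x * UnitAddTorus.mFourier n (torusMk x) ∂μ = 0)
    {K : Set (UnitAddTorus (Fin d))} (hK : IsClosed K) :
    ∫ x, (torusMk ⁻¹' K).indicator Φ x ∂μ = 0 := by
  have hδ : ∀ n : ℕ, (0 : ℝ) < 1 / ((n : ℝ) + 1) := fun n => by positivity
  have hlim := thickenedIndicator_tendsto_indicator_closure hδ
    tendsto_one_div_add_atTop_nhds_zero_nat K
  rw [hK.closure_eq, tendsto_pi_nhds] at hlim
  have key : Filter.Tendsto (fun n : ℕ => ∫ x, Φ x *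
      (((thickenedIndicator (hδ n) K (torusMk x) : ℝ≥0) : ℝ) : ℂ) ∂μ) Filter.atTop
      (nhds (∫ x, (torusMk ⁻¹' K).indicator Φ x ∂μ)) := by
    refine tendsto_integral_of_dominated_convergence (fun x => ‖Φ x‖) (fun n => ?_) hΦ.norm
      (fun n => Filter.Eventually.of_forall fun x => ?_) (Filter.Eventually.of_forall fun x => ?_)
    · refine hΦ.1.mul (Continuous.aestronglyMeasurable ?_)
      exact Complex.continuous_ofReal.comp (NNReal.continuous_coe.comp
        ((thickenedIndicator (hδ n) K).continuous.comp continuous_torusMk))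
    · rw [norm_mul, Complex.norm_real, NNReal.norm_eq]
      exact mul_le_of_le_one_right (norm_nonneg _)
        (by exact_mod_cast thickenedIndicator_le_one (hδ n) K _)
    · have := ((Complex.continuous_ofReal.comp NNReal.continuous_coe).tendsto _).comp
        (hlim (torusMk x))
      convert! this.const_mul (Φ x) using 2
      by_cases hx : torusMk x ∈ K
      · rw [indicator_of_mem (show x ∈ torusMk ⁻¹' K from hx)]; simp [hx]
      · rw [indicator_of_notMem (show x ∉ torusMk ⁻¹' K from hx)]; simp [hx]
  refine tendsto_nhds_unique key ?_
  refine tendsto_const_nhds.congr fun n => ?_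
  exact (integral_mul_torus_eq_zero hΦ h
    ⟨fun t => (((thickenedIndicator (hδ n) K t : ℝ≥0) : ℝ) : ℂ),
    Complex.continuous_ofReal.comp (NNReal.continuous_coe.comp
        (thickenedIndicator (hδ n) K).continuous)⟩).symm

/-- Uniqueness of Fourier coefficients for integrable functions on the unit cube. -/
theorem ae_eq_zero_of_fourierCoeff_eq_zero {Φ : E d → ℂ} (hΦ : IntegrableOn Φ (halfOpenCube d))
    (h : ∀ n : Fin d → ℤ,
      ∫ x in halfOpenCube d, Φ x * UnitAddTorus.mFourier n (torusMk x) = 0) :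
    ∀ᵐ x ∂volume.restrict (halfOpenCube d), Φ x = 0 := by
  rw [IntegrableOn, ← restrict_unitCube] at hΦ
  rw [← restrict_unitCube] at h ⊢
  refine ae_eq_zero_of_forall_setIntegral_isCompact_eq_zero hΦ fun K hK => ?_
  have hm : MeasurableSet (unitCube d) := isCompact_unitCube.isClosed.measurableSet
  -- The image of `K ∩ unitCube d` in the torus is compact, and its preimage agrees with `K` on the
  -- cube away from the faces.
  have h1 := integral_torus_indicator_eq_zero hΦ h
    (K := torusMk '' (K ∩ unitCube d))
    ((hK.inter isCompact_unitCube).image continuous_torusMk).isClosed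
  rw [← integral_indicator hK.measurableSet, ← h1]
  refine integral_congr_ae ?_
  rw [Filter.EventuallyEq, ae_restrict_iff' hm]
  filter_upwards [ae_mem_Ioo_of_mem_unitCube (d := d)] with x hx hxc
  by_cases hxK : x ∈ K
  · rw [indicator_of_mem hxK, indicator_of_mem
      (show x ∈ torusMk ⁻¹' (torusMk '' (K ∩ unitCube d)) from mem_image_of_mem _ ⟨hxK, hxc⟩)]
  · rw [indicator_of_notMem hxK, indicator_of_notMem]
    rintro ⟨y, ⟨hyK, hyc⟩, hxy⟩
    rw [eq_of_torusMk_eq (hx hxc) hyc hxy.symm] at hxK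
    exact hxK hyK

theorem integral_cube_mFourier {n : Fin d → ℤ} (hn : n ≠ 0) :
    ∫ x in halfOpenCube d, UnitAddTorus.mFourier n (torusMk x) = 0 := by
  obtain ⟨i, hi⟩ : ∃ i, n i ≠ 0 := Function.ne_iff.1 hn
  -- Chosen so that `(t, n) = 1/2`: translation by `t` changes the sign of the character, while its
  -- integral over a period is unchanged.
  set t : E d := EuclideanSpace.single i (1 / (2 * (n i : ℝ)))
  have ht : inner ℝ t (latticePt n) = (1 / 2 : ℝ) := by
    have : (n i : ℝ) ≠ 0 := by exact_mod_cast hi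
    simp only [t, EuclideanSpace.inner_single_left, conj_trivial, latticePt_apply]
    field_simp
  have hchar : ∀ x, UnitAddTorus.mFourier n (torusMk (x + t)) =
      -UnitAddTorus.mFourier n (torusMk x) := by
    intro x
    rw [mFourier_torusMk, mFourier_torusMk, inner_add_left, ht, AddChar.map_add_eq_mul,
      Circle.coe_mul]
    have : (Real.fourierChar (1 / 2) : ℂ) = -1 := by
      rw [Real.fourierChar_apply, ← Complex.exp_pi_mul_I]
      congr 1; push_cast; ring
    rw [this]; ring
  have hcont : Continuous fun x : E d => UnitAddTorus.mFourier n (torusMk x) :=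
    (UnitAddTorus.mFourier n).continuous.comp continuous_torusMk
  set u : E d → ℂ := (halfOpenCube d).indicator fun x => UnitAddTorus.mFourier n (torusMk x)
  have hu : Integrable u := by
    rw [integrable_indicator_iff measurableSet_halfOpenCube]
    refine Measure.integrableOn_of_bounded (M := 1) volume_halfOpenCube_lt_top.ne
      hcont.aestronglyMeasurable (Filter.Eventually.of_forall fun x => ?_)
    exact norm_mFourier_torusMk_le n x
  have h1 : ∫ x in halfOpenCube d, UnitAddTorus.mFourier n (torusMk x) = ∫ x, u (x + t) := by
    rw [integral_add_right_eq_self u t, integral_indicator measurableSet_halfOpenCube]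
  have h2 : ∫ x, u (x + t) = ∫ x in halfOpenCube d, -UnitAddTorus.mFourier n (torusMk x) := by
    rw [integral_eq_integral_cube (hu.comp_add_right t)]
    refine integral_congr_ae (Filter.Eventually.of_forall fun x => ?_)
    simp only
    have hmem := add_latticePt_mem_halfOpenCube_iff (x + t)
    -- Exactly one lattice translate of `x + t` lies in the half-open cube.
    rw [tsum_eq_single (fun i => -⌊(x + t) i + 1 / 2⌋)]
    · rw [add_right_comm]
      simp only [u]
      rw [indicator_of_mem ((hmem _).2 rfl), add_right_comm, hchar, torusMk_add_latticePt]
    · intro k hk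
      rw [add_right_comm]
      exact indicator_of_notMem (fun h => hk ((hmem _).1 h)) _
  rw [integral_neg, ← h1] at h2
  exact self_eq_neg.1 h2

/-- An integrable function whose Fourier transform vanishes at all nonzero lattice points has
almost everywhere constant periodization. -/
theorem ae_tsum_eq_integral {ψ : E d → ℂ} (hψ : Integrable ψ)
    (h : ∀ l : Fin d → ℤ, l ≠ 0 → 𝓕 ψ (latticePt l) = 0) :
    ∀ᵐ x, ∑' k : Fin d → ℤ, ψ (x + latticePt k) = ∫ y, ψ y := by
  refine ae_of_ae_restrict_halfOpenCube (fun x k h => ?_) ?_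
  · rw [← (Equiv.addLeft k).tsum_eq]
    simpa [latticePt_add, add_assoc] using h
  have hP := integrableOn_cube_tsum hψ
  have hΦ : IntegrableOn (fun x => (∑' k : Fin d → ℤ, ψ (x + latticePt k)) - ∫ y, ψ y)
      (halfOpenCube d) := hP.sub (integrable_const _)
  have hvol : volume.real (halfOpenCube d) = 1 := by
    rw [Measure.real, measure_congr halfOpenCube_ae_eq_unitCube, ← ofLp_preimage_Icc,
      (PiLp.volume_preserving_ofLp (Fin d)).measure_preimage measurableSet_Icc.nullMeasurableSet,
      Real.volume_Icc_pi]
    norm_num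
  refine (ae_eq_zero_of_fourierCoeff_eq_zero hΦ fun n => ?_).mono fun x hx => sub_eq_zero.1 hx
  have hcont : Continuous fun x : E d => UnitAddTorus.mFourier n (torusMk x) :=
    (UnitAddTorus.mFourier n).continuous.comp continuous_torusMk
  have hbd : ∀ x : E d, ‖UnitAddTorus.mFourier n (torusMk x)‖ ≤ 1 :=
    norm_mFourier_torusMk_le n
  have hi1 := hψ.mul_bdd (c := 1) hcont.aestronglyMeasurable (Filter.Eventually.of_forall hbd)
  have hi2 := hP.mul_bdd (c := 1) hcont.aestronglyMeasurable (Filter.Eventually.of_forall hbd)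
  have hi3 := (integrable_const (μ := volume.restrict (halfOpenCube d)) (∫ y, ψ y)).mul_bdd (c := 1)
    hcont.aestronglyMeasurable (Filter.Eventually.of_forall hbd)
  simp only [sub_mul]
  rw [integral_sub hi2 hi3, integral_const_mul]
  have e1 : ∫ x in halfOpenCube d, (∑' k : Fin d → ℤ, ψ (x + latticePt k)) *
      UnitAddTorus.mFourier n (torusMk x) = ∫ x, ψ x * UnitAddTorus.mFourier n (torusMk x) := by
    rw [integral_eq_integral_cube hi1]
    simp only [torusMk_add_latticePt, tsum_mul_right]
  rw [e1]
  -- At `n = 0` the subtracted constant cancels the mean, as the cube has volume one. At `n ≠ 0` the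
  -- constant contributes nothing, and the remaining coefficient is `𝓕 ψ` at `-n`, since `mFourier
  -- n` carries the opposite sign.
  rcases eq_or_ne n 0 with rfl | hn
  · simp [UnitAddTorus.mFourier_zero, hvol]
  · rw [integral_cube_mFourier hn, mul_zero, sub_zero, ← h (-n) (neg_ne_zero.2 hn), Real.fourier_eq]
    refine integral_congr_ae (Filter.Eventually.of_forall fun x => ?_)
    simp only [mFourier_torusMk, latticePt_neg, inner_neg_right, neg_neg, Circle.smul_def,
      smul_eq_mul]
    ring

/-! ### Fourier inversion and the multiplication formula. -/

/-- Brings general facts about `VectorFourier.fourierIntegral` to bear on `𝓕⁻`, through the negated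
inner product. -/
theorem fourierInv_eq_fourier_flip (f : E d → ℂ) :
    𝓕⁻ f = VectorFourier.fourierIntegral Real.fourierChar volume (-innerₗ (E d)) f := by
  ext w
  rw [Real.fourierInv_eq]
  simp [VectorFourier.fourierIntegral]

/-- The multiplication formula for the inverse Fourier transform. -/
theorem integral_fourierInv_mul {f g : E d → ℂ} (hf : Integrable f) (hg : Integrable g) :
    ∫ x, 𝓕⁻ f x * g x = ∫ x, f x * 𝓕⁻ g x := by
  rw [fourierInv_eq_fourier_flip, fourierInv_eq_fourier_flip]
  have hflip : (-innerₗ (E d)).flip = -innerₗ (E d) := by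
    ext x y; simp [real_inner_comm]
  have h := VectorFourier.integral_fourierIntegral_smul_eq_flip (e := Real.fourierChar)
    (μ := volume) (ν := volume) (L := -innerₗ (E d)) (f := f) (g := g) Real.continuous_fourierChar
    (by
      have : Continuous fun p : E d × E d => -(inner ℝ p.1 p.2 : ℝ) := by fun_prop
      simpa using this) hf hg
  rw [hflip] at h
  simpa only [smul_eq_mul] using h

theorem continuous_fourier {f : E d → ℂ} (hf : Integrable f) : Continuous (𝓕 f) :=
  VectorFourier.fourierIntegral_continuous (L := innerₗ (E d)) Real.continuous_fourierChar
    (by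
      have : Continuous fun p : E d × E d => (inner ℝ p.1 p.2 : ℝ) := by fun_prop
      simpa using this) hf

theorem norm_fourier_le (f : E d → ℂ) (ξ : E d) : ‖𝓕 f ξ‖ ≤ ∫ x, ‖f x‖ :=
  VectorFourier.norm_fourierIntegral_le_integral_norm _ _ (innerₗ (E d)) f ξ

theorem continuous_fourierInv {f : E d → ℂ} (hf : Integrable f) : Continuous (𝓕⁻ f) := by
  rw [fourierInv_eq_fourier_flip]
  refine VectorFourier.fourierIntegral_continuous Real.continuous_fourierChar ?_ hf
  have : Continuous fun p : E d × E d => -(inner ℝ p.1 p.2 : ℝ) := by fun_prop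
  simpa using this

/-- On a set of finite measure, `L_2` embeds in `L_1`. -/
theorem integrable_of_memLp_two_of_suppIn {h : E d → ℂ} (hh : MemLp h 2 volume) {A : Set (E d)}
    (hA : MeasurableSet A) (hAfin : volume A < ∞) (hsupp : SuppIn h A) : Integrable h := by
  have : IsFiniteMeasure (volume.restrict A) := ⟨by simpa using hAfin⟩
  have h1 : IntegrableOn h A := (hh.restrict A).integrable (by norm_num)
  refine (h1.integrable_indicator hA).congr ?_
  filter_upwards [hsupp] with x hx
  by_cases hxA : x ∈ A
  · rw [indicator_of_mem hxA]
  · rw [indicator_of_notMem hxA, hx hxA]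

open SchwartzMap in
/-- Fourier inversion for an `L_2` function whose Fourier transform is integrable. -/
theorem ae_eq_fourierInv_of_integrable_fourier {g : E d → ℂ} (hg : MemLp g 2 volume)
    (hint : Integrable (𝓕 (hg.toLp g) : Lp ℂ 2 (volume : Measure (E d)))) :
    g =ᵐ[volume] 𝓕⁻ ((𝓕 (hg.toLp g) : Lp ℂ 2 (volume : Measure (E d))) : E d → ℂ) := by
  set u : Lp ℂ 2 (volume : Measure (E d)) := 𝓕 (hg.toLp g)
  have hu : 𝓕⁻ u = hg.toLp g := by simp [u]
  -- Tested against smooth compactly supported `s`: the distributional transform moves `𝓕⁻` onto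
  -- `s`, and the multiplication formula moves it back to the integrable function `u`.
  refine ae_eq_of_integral_contDiff_smul_eq (hg.locallyIntegrable (by norm_num))
    (continuous_fourierInv hint).locallyIntegrable fun s hs hsc => ?_
  have hs' : ContDiff ℝ (⊤ : ℕ∞) fun x => (s x : ℂ) := Complex.ofRealCLM.contDiff.comp hs
  have hsc' : HasCompactSupport fun x => (s x : ℂ) := hsc.comp_left (g := Complex.ofReal) (by simp)
  set S : 𝓢(E d, ℂ) := hsc'.toSchwartzMap hs'
  have hS : ∀ x, S x = (s x : ℂ) := fun x => rfl
  have h1 := congrArg (fun T : 𝓢'(E d, ℂ) => T S)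
    (Lp.fourierInv_toTemperedDistribution_eq u)
  simp only [TemperedDistribution.fourierInv_apply, Lp.toTemperedDistribution_apply, hu] at h1
  have h2 : ∫ x, s x • g x = ∫ x, S x • (hg.toLp g) x := by
    refine integral_congr_ae ?_
    filter_upwards [hg.coeFn_toLp] with x hx
    rw [hx, hS]; simp
  rw [h2, ← h1, SchwartzMap.fourierInv_coe]
  simp only [smul_eq_mul]
  rw [integral_fourierInv_mul S.integrable hint]
  simp [hS]

/-! ### Poisson summation and reproduction of band-limited functions. -/

/-- The exponential `e^{2πi(x, ξ)}`. -/
def expChar (x ξ : E d) : ℂ := (Real.fourierChar (inner ℝ x ξ) : ℂ)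

theorem expChar_add_left (x y ξ : E d) : expChar (x + y) ξ = expChar x ξ * expChar y ξ := by
  rw [expChar, inner_add_left, AddChar.map_add_eq_mul, Circle.coe_mul]; rfl

theorem expChar_add_right (x ξ η : E d) : expChar x (ξ + η) = expChar x ξ * expChar x η := by
  rw [expChar, inner_add_right, AddChar.map_add_eq_mul, Circle.coe_mul]; rfl

theorem norm_expChar (x ξ : E d) : ‖expChar x ξ‖ = 1 := Circle.norm_coe _

theorem conj_expChar (x ξ : E d) : conj (expChar x ξ) = expChar (-x) ξ := by
  rw [expChar, expChar, inner_neg_left, AddChar.map_neg_eq_inv, Circle.coe_inv_eq_conj]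

theorem expChar_neg_mul (x ξ : E d) : expChar (-x) ξ * expChar x ξ = 1 := by
  rw [← expChar_add_left, neg_add_cancel]; simp [expChar]

theorem continuous_expChar {X : Type*} [TopologicalSpace X] {f g : X → E d} (hf : Continuous f)
    (hg : Continuous g) : Continuous fun x => expChar (f x) (g x) := by
  unfold expChar
  exact continuous_induced_dom.comp (Real.continuous_fourierChar.comp (hf.inner hg))

theorem fourier_eq_expChar (f : E d → ℂ) (ξ : E d) : 𝓕 f ξ = ∫ x, expChar (-x) ξ * f x := by
  rw [Real.fourier_eq]
  simp [expChar, Circle.smul_def]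

theorem fourierInv_eq_expChar (f : E d → ℂ) (ξ : E d) : 𝓕⁻ f ξ = ∫ x, expChar x ξ * f x := by
  rw [Real.fourierInv_eq]
  simp [expChar, Circle.smul_def]

theorem expChar_comm (x ξ : E d) : expChar x ξ = expChar ξ x := by
  rw [expChar, expChar, real_inner_comm]

theorem fourier_comp_add (f : E d → ℂ) (t ξ : E d) :
    𝓕 (fun x => f (x + t)) ξ = expChar t ξ * 𝓕 f ξ := by
  rw [fourier_eq_expChar, fourier_eq_expChar, ← integral_const_mul,
    ← integral_add_right_eq_self (fun x => expChar t ξ * (expChar (-x) ξ * f x)) t]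
  refine integral_congr_ae (Filter.Eventually.of_forall fun x => ?_)
  simp only
  rw [neg_add, expChar_add_left]
  linear_combination (-(expChar (-x) ξ * f (x + t))) * expChar_neg_mul t ξ

theorem fourierInv_conj (f : E d → ℂ) (ξ : E d) :
    𝓕⁻ (fun x => conj (f x)) ξ = conj (𝓕 f ξ) := by
  rw [fourierInv_eq_expChar, fourier_eq_expChar, ← integral_conj]
  refine integral_congr_ae (Filter.Eventually.of_forall fun x => ?_)
  simp [conj_expChar]

/-- The Poisson summation formula at frequencies where only one term survives. -/
theorem ae_tsum_expChar_eq_fourier {φ : E d → ℂ} (hφ : Integrable φ) {ξ : E d}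
    (h : ∀ l : Fin d → ℤ, l ≠ 0 → 𝓕 φ (ξ + latticePt l) = 0) :
    ∀ᵐ x, ∑' k : Fin d → ℤ, expChar (-latticePt k) ξ * φ (x + latticePt k) =
      expChar x ξ * 𝓕 φ ξ := by
  have hc : Continuous fun x : E d => expChar (-x) ξ :=
    continuous_expChar continuous_neg continuous_const
  have hψ : Integrable fun x => expChar (-x) ξ * φ x :=
    hφ.bdd_mul (c := 1) hc.aestronglyMeasurable
      (Filter.Eventually.of_forall fun x => (norm_expChar _ _).le)
  -- Modulation by `ξ` translates the transform by `ξ`, so the hypothesis says that the modulated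
  -- function has constant periodization.
  have h2 : ∀ l : Fin d → ℤ, l ≠ 0 → 𝓕 (fun x => expChar (-x) ξ * φ x) (latticePt l) = 0 := by
    intro l hl
    rw [← h l hl, fourier_eq_expChar, fourier_eq_expChar]
    refine integral_congr_ae (Filter.Eventually.of_forall fun x => ?_)
    simp only
    rw [expChar_add_right]; ring
  filter_upwards [ae_tsum_eq_integral hψ h2] with x hx
  rw [fourier_eq_expChar, ← hx, ← tsum_mul_left]
  refine tsum_congr fun k => ?_
  rw [neg_add, expChar_add_left]
  linear_combination (-(expChar (-latticePt k) ξ * φ (x + latticePt k))) * expChar_neg_mul x ξ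

/-- Expresses the coefficients on the frequency side: conjugation exchanges `𝓕` and `𝓕⁻`, and the
shift by `k` becomes a modulation. -/
theorem integral_fourierInv_mul_conj_shift {H φt : E d → ℂ} (hH : Integrable H)
    (hφt : Integrable φt) (k : Fin d → ℤ) :
    ∫ y, 𝓕⁻ H y * conj (φt (y + latticePt k)) =
      ∫ ξ, H ξ * (conj (𝓕 φt ξ) * expChar (-latticePt k) ξ) := by
  have hs : Integrable fun y => conj (φt (y + latticePt k)) :=
    (LinearIsometryEquiv.integrable_comp_iff Complex.conjLIE).2 (hφt.comp_add_right _)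
  rw [integral_fourierInv_mul hH hs]
  refine integral_congr_ae (Filter.Eventually.of_forall fun ξ => ?_)
  simp only
  rw [fourierInv_conj (fun y => φt (y + latticePt k)), fourier_comp_add, map_mul, conj_expChar]
  ring

/-- Reproduction of band-limited functions, for a strongly measurable generator. -/
theorem ae_tsum_eq_fourierInv_of_measurable {φ φt H : E d → ℂ} (hφm : Measurable φ)
    (hφ : Integrable φ) (hφt : Integrable φt) {δ : ℝ} (hcomp : StrictlyCompatible φ φt δ)
    (hδφ : ∀ l : Fin d → ℤ, l ≠ 0 → ∀ᵐ ξ : E d, ‖ξ - latticePt l‖ < δ → 𝓕 φ ξ = 0)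
    (hH : Integrable H) (hHs : ∀ᵐ ξ, ¬ ‖ξ‖ < δ → H ξ = 0) :
    ∀ᵐ x, ∑' k : Fin d → ℤ, (∫ y, 𝓕⁻ H y * conj (φt (y + latticePt k))) * φ (x + latticePt k) =
      𝓕⁻ H x := by
  have hzero : ∀ᵐ ξ : E d, ∀ l : Fin d → ℤ, l ≠ 0 → ‖ξ‖ < δ → 𝓕 φ (ξ + latticePt l) = 0 := by
    refine ae_all_iff.2 fun l => ?_
    by_cases hl : l = 0
    · simp [hl]
    have := (measurePreserving_add_right volume (latticePt l)).quasiMeasurePreserving.ae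
      (hδφ l hl)
    filter_upwards [this] with ξ hξ _ hξδ
    exact hξ (by simpa using hξδ)
  -- Poisson summation has an exceptional set of `x` depending on `ξ`. Fubini exchanges the
  -- quantifiers; this needs joint measurability, hence a measurable `φ`.
  have hswap : ∀ᵐ x : E d, ∀ᵐ ξ : E d, ‖ξ‖ < δ →
      ∑' k : Fin d → ℤ, expChar (-latticePt k) ξ * φ (x + latticePt k) =
        expChar x ξ * 𝓕 φ ξ := by
    refine (Measure.ae_ae_comm ?_).2 ?_
    · have m1 : MeasurableSet {z : E d × E d | ‖z.2‖ < δ} :=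
        (isOpen_lt (by fun_prop) continuous_const).measurableSet
      have m2 : Measurable fun z : E d × E d =>
          ∑' k : Fin d → ℤ, expChar (-latticePt k) z.2 * φ (z.1 + latticePt k) := by
        refine Measurable.tsum fun k => Measurable.mul ?_ (hφm.comp (by fun_prop))
        exact (continuous_expChar continuous_const continuous_snd).measurable
      have m3 : Measurable fun z : E d × E d => expChar z.1 z.2 * 𝓕 φ z.2 :=
        ((continuous_expChar continuous_fst continuous_snd).mul
          ((continuous_fourier hφ).comp continuous_snd)).measurable
      exact (m1.imp (measurableSet_eq_fun m2 m3))
    · filter_upwards [hzero] with ξ hξ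
      by_cases hξδ : ‖ξ‖ < δ
      · filter_upwards [ae_tsum_expChar_eq_fourier hφ fun l hl => hξ l hl hξδ] with x hx _ using hx
      · exact Filter.Eventually.of_forall fun x h => absurd h hξδ
  have hcE : ∀ x : E d, Continuous fun ξ : E d => expChar x ξ := fun x =>
    continuous_expChar continuous_const continuous_id
  have hHt : Integrable fun ξ => H ξ * conj (𝓕 φt ξ) :=
    hH.mul_bdd (c := ∫ x, ‖φt x‖)
      (Complex.continuous_conj.comp (continuous_fourier hφt)).aestronglyMeasurable
      (Filter.Eventually.of_forall fun ξ => by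
        rw [RCLike.norm_conj]; exact norm_fourier_le φt ξ)
  have hHk : ∀ (x : E d) (k : Fin d → ℤ), Integrable fun ξ =>
      H ξ * conj (𝓕 φt ξ) * (expChar (-latticePt k) ξ * φ (x + latticePt k)) := fun x k =>
    hHt.mul_bdd (c := ‖φ (x + latticePt k)‖) ((hcE _).mul continuous_const).aestronglyMeasurable
      (Filter.Eventually.of_forall fun ξ => by rw [norm_mul, norm_expChar, one_mul])
  filter_upwards [hswap, ae_summable_comp_add hφ] with x hx hsum
  -- Sum and integral may be exchanged because the exponentials are unimodular and `∑ |φ(x + k)|` is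
  -- finite for almost every `x`.
  have hs : HasSum (fun k : Fin d → ℤ => ∫ ξ, H ξ * conj (𝓕 φt ξ) *
      (expChar (-latticePt k) ξ * φ (x + latticePt k))) _ :=
    hasSum_integral_of_summable_integral_norm (hHk x) (by
      simp only [norm_mul, norm_expChar, one_mul, integral_mul_const]
      exact hsum.mul_left _)
  calc _ = ∑' k : Fin d → ℤ, ∫ ξ, H ξ * conj (𝓕 φt ξ) *
      (expChar (-latticePt k) ξ * φ (x + latticePt k)) := by
        refine tsum_congr fun k => ?_
        rw [integral_fourierInv_mul_conj_shift hH hφt, ← integral_mul_const]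
        refine integral_congr_ae (Filter.Eventually.of_forall fun ξ => ?_)
        simp only; ring
    _ = _ := hs.tsum_eq
    _ = _ := by
        rw [fourierInv_eq_expChar]
        refine integral_congr_ae ?_
        filter_upwards [hx, hHs, hcomp] with ξ h1 h2 h3
        by_cases hξ : ‖ξ‖ < δ
        · rw [tsum_mul_left, h1 hξ, expChar_comm ξ x]
          have h4 := congrArg conj (h3 hξ)
          simp only [map_mul, Complex.conj_conj, map_one] at h4
          linear_combination (H ξ * expChar x ξ) * h4
        · simp [h2 hξ]

/-- Reproduction of band-limited functions by the quasi-projection of level zero. -/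
theorem ae_tsum_eq_of_bandLimited {φ φt H G : E d → ℂ}
    (hφ : Integrable φ) (hφt : Integrable φt) {δ : ℝ} (hcomp : StrictlyCompatible φ φt δ)
    (hδφ : ∀ l : Fin d → ℤ, l ≠ 0 → ∀ᵐ ξ : E d, ‖ξ - latticePt l‖ < δ → 𝓕 φ ξ = 0)
    (hH : Integrable H) (hHs : ∀ᵐ ξ, ¬ ‖ξ‖ < δ → H ξ = 0) (hG : G =ᵐ[volume] 𝓕⁻ H) :
    ∀ᵐ x, ∑' k : Fin d → ℤ, pairing G (fun y => φt (y + latticePt k)) * φ (x + latticePt k) =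
      G x := by
  -- A measurable representative of `φ` has the same transform, and its lattice shifts agree with
  -- those of `φ` off one null set, since the lattice is countable.
  obtain ⟨φ', hφ'm, hφ'⟩ := hφ.1
  have hF : 𝓕 φ = 𝓕 φ' := VectorFourier.fourierIntegral_congr_ae _ _ (innerₗ (E d)) hφ'
  have hcomp' : StrictlyCompatible φ' φt δ := by
    unfold StrictlyCompatible at hcomp ⊢; rwa [← hF]
  have key := ae_tsum_eq_fourierInv_of_measurable hφ'm.measurable (hφ.congr hφ') hφt hcomp'
    (by rwa [← hF]) hH hHs
  have hall : ∀ᵐ x : E d, ∀ k : Fin d → ℤ, φ (x + latticePt k) = φ' (x + latticePt k) :=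
    ae_all_iff.2 fun k =>
      (measurePreserving_add_right volume (latticePt k)).quasiMeasurePreserving.ae hφ'
  filter_upwards [key, hall, hG] with x h1 h2 h3
  rw [h3, ← h1]
  refine tsum_congr fun k => ?_
  rw [h2 k]
  congr 1
  refine integral_congr_ae ?_
  filter_upwards [hG] with y hy
  rw [hy]

/-! ### Weighted boundedness at level zero. -/

theorem calNorm_eq (φ : E d → ℂ) (p : ℝ≥0∞) :
    calNorm φ p = eLpNorm (periodize fun x => ‖φ x‖ₑ) p (volume.restrict (halfOpenCube d)) := by
  rw [calNorm, restrict_unitCube]; rfl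

theorem MemCal.integrable {φ : E d → ℂ} {p : ℝ≥0∞} (hp : 1 ≤ p) (h : MemCal φ p) :
    Integrable φ := by
  refine ⟨h.1.1, ?_⟩
  have h2 := h.2
  rw [calNorm_eq] at h2
  rw [HasFiniteIntegral, lintegral_eq_lintegral_periodize h.1.1.enorm]
  exact lintegral_periodize_lt_top hp h.1.1.enorm h2

theorem ae_lt_top_of_eLpNorm_lt_top {α : Type*} [MeasurableSpace α] {μ : Measure α} {p : ℝ≥0∞}
    (hp : p ≠ 0) {f : α → ℝ≥0∞} (hf : AEMeasurable f μ) (h : eLpNorm f p μ < ∞) :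
    ∀ᵐ x ∂μ, f x < ∞ := by
  rcases eq_or_ne p ∞ with rfl | hpt
  · filter_upwards [enorm_ae_le_eLpNormEssSup f μ] with x hx
    exact lt_of_le_of_lt (by simpa using hx) (by simpa using h)
  · rw [eLpNorm_ennreal_eq_lintegral hp hpt] at h
    have hr : 0 < p.toReal := ENNReal.toReal_pos hp hpt
    have h2 : ∫⁻ x, f x ^ p.toReal ∂μ ≠ ∞ := by
      intro h3
      rw [h3, ENNReal.top_rpow_of_pos (by positivity)] at h
      exact lt_irrefl _ h
    filter_upwards [ae_lt_top' (hf.pow_const _) h2] with x hx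
    exact (ENNReal.rpow_lt_top_iff_of_pos hr).1 hx

/-- The quasi-projection operator of level zero. -/
def levelZero (φ φt F : E d → ℂ) (x : E d) : ℂ :=
  ∑' k : Fin d → ℤ, pairing F (fun y => φt (y + latticePt k)) * φ (x + latticePt k)

/-- A positive measurable weight `v` that is moderate with respect to `ws`. -/
structure IsModerate (v ws : E d → ℝ) (C : ℝ) : Prop where
  pos : ∀ x, 0 < v x
  measurable : Measurable v
  const_nonneg : 0 ≤ C
  star_even : ∀ x, ws (-x) = ws x
  star_nonneg : ∀ x, 0 ≤ ws x
  submul : ∀ x y, v (x + y) ≤ C * ws x * v y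

section LevelZero

variable {v ws : E d → ℝ} {C : ℝ}

theorem aestronglyMeasurable_of_memWLp (hv : IsModerate v ws C) {F : E d → ℂ} {p : ℝ≥0∞}
    (hF : MemWLp F p fun x => 1 / v x) : AEStronglyMeasurable F volume := by
  have : F = fun x => F x * ((1 / v x : ℝ) : ℂ) * (v x : ℂ) := by
    ext x
    have : (v x : ℂ) ≠ 0 := Complex.ofReal_ne_zero.2 (hv.pos x).ne'
    push_cast
    field_simp
  rw [this]
  exact hF.1.mul (Complex.measurable_ofReal.comp hv.measurable).aestronglyMeasurable

/-- Moderateness applied to `y = (y + k) + (-k)`: the weight at `y` costs `ws` on the argument of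
`φt` and a factor `v (-k)`. -/
theorem norm_mul_shift_le (hv : IsModerate v ws C) (F φt : E d → ℂ) (k : Fin d → ℤ) (y : E d) :
    ‖F y * conj (φt (y + latticePt k))‖ ≤ C * v (-latticePt k) *
      ‖(F y * ((1 / v y : ℝ) : ℂ)) * (φt (y + latticePt k) * (ws (y + latticePt k) : ℂ))‖ := by
  have h := hv.submul (y + latticePt k) (-latticePt k)
  rw [add_neg_cancel_right] at h
  have h0 := hv.pos y
  simp only [norm_mul, RCLike.norm_conj, Complex.norm_real, Real.norm_eq_abs,
    abs_of_nonneg (hv.star_nonneg _), abs_of_pos (one_div_pos.2 h0)]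
  calc ‖F y‖ * ‖φt (y + latticePt k)‖
      = ‖F y‖ * (1 / v y) * ‖φt (y + latticePt k)‖ * v y := by field_simp
    _ ≤ ‖F y‖ * (1 / v y) * ‖φt (y + latticePt k)‖ *
        (C * ws (y + latticePt k) * v (-latticePt k)) := by gcongr
    _ = _ := by ring

/-- Moderateness applied to `-k = -(x + k) + x`, with `ws` even: the factor `v (-k)` left by the
coefficient is absorbed by `φ`. -/
theorem weight_mul_norm_shift_le (hv : IsModerate v ws C) (φ : E d → ℂ) (k : Fin d → ℤ) (x : E d) :
    v (-latticePt k) * (‖φ (x + latticePt k)‖ * ‖((1 / v x : ℝ) : ℂ)‖) ≤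
      C * ‖φ (x + latticePt k) * (ws (x + latticePt k) : ℂ)‖ := by
  have h := hv.submul (-(x + latticePt k)) x
  rw [neg_add_rev, neg_add_cancel_right, ← neg_add_rev, hv.star_even] at h
  have h0 := hv.pos x
  simp only [norm_mul, Complex.norm_real, Real.norm_eq_abs,
    abs_of_nonneg (hv.star_nonneg _), abs_of_pos (one_div_pos.2 h0)]
  calc v (-latticePt k) * (‖φ (x + latticePt k)‖ * (1 / v x))
      ≤ (C * ws (x + latticePt k) * v x) * (‖φ (x + latticePt k)‖ * (1 / v x)) := by gcongr
    _ = _ := by field_simp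

variable {φ φt F : E d → ℂ} {p q : ℝ≥0∞}

theorem integrable_mul_conj_shift (hv : IsModerate v ws C)
    (hpq : 1 / p + 1 / q = 1) (hφtm : AEStronglyMeasurable φt volume)
    (hφt : MemWCal φt q ws) (hF : MemWLp F p fun x => 1 / v x) (k : Fin d → ℤ) :
    Integrable fun y => F y * conj (φt (y + latticePt k)) := by
  have : p.HolderTriple q 1 := ⟨by simpa using hpq⟩
  have hs : MemLp (fun y => φt (y + latticePt k) * (ws (y + latticePt k) : ℂ)) q volume :=
    hφt.1.comp_measurePreserving (measurePreserving_add_right volume (latticePt k))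
  have h1 := (MemLp.integrable_mul hF hs).norm.const_mul (C * v (-latticePt k))
  refine h1.mono' ?_ (Filter.Eventually.of_forall fun y => norm_mul_shift_le hv F φt k y)
  refine (aestronglyMeasurable_of_memWLp hv hF).mul ?_
  exact Complex.continuous_conj.comp_aestronglyMeasurable (hφtm.comp_measurePreserving
    (measurePreserving_add_right volume (latticePt k)))

theorem tsum_enorm_mul_weight_le (hv : IsModerate v ws C) (φ φt F : E d → ℂ) (x : E d) :
    (∑' k : Fin d → ℤ, ‖pairing F (fun y => φt (y + latticePt k)) * φ (x + latticePt k)‖ₑ) *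
      ‖((1 / v x : ℝ) : ℂ)‖ₑ ≤ ENNReal.ofReal (C ^ 2) * latticeSynth
        (latticeCorr (fun y => ‖F y * ((1 / v y : ℝ) : ℂ)‖ₑ) fun y => ‖φt y * (ws y : ℂ)‖ₑ)
        (fun y => ‖φ y * (ws y : ℂ)‖ₑ) x := by
  have hC := hv.const_nonneg
  rw [← ENNReal.tsum_mul_right, latticeSynth, ← ENNReal.tsum_mul_left]
  refine ENNReal.tsum_le_tsum fun k => ?_
  have hvk := (hv.pos (-latticePt k)).le
  have h1 : ‖pairing F (fun y => φt (y + latticePt k))‖ₑ ≤ ENNReal.ofReal (C * v (-latticePt k)) *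
      latticeCorr (fun y => ‖F y * ((1 / v y : ℝ) : ℂ)‖ₑ) (fun y => ‖φt y * (ws y : ℂ)‖ₑ) k := by
    refine (enorm_integral_le_lintegral_enorm _).trans ?_
    rw [latticeCorr, ← lintegral_const_mul' _ _ ENNReal.ofReal_ne_top]
    refine lintegral_mono fun y => ?_
    rw [← enorm_mul, ← ofReal_norm, ← ofReal_norm, ← ENNReal.ofReal_mul (by positivity)]
    exact ENNReal.ofReal_le_ofReal (norm_mul_shift_le hv F φt k y)
  have h2 : ENNReal.ofReal (v (-latticePt k)) *
      (‖φ (x + latticePt k)‖ₑ * ‖((1 / v x : ℝ) : ℂ)‖ₑ) ≤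
      ENNReal.ofReal C * ‖φ (x + latticePt k) * (ws (x + latticePt k) : ℂ)‖ₑ := by
    rw [← ofReal_norm, ← ofReal_norm, ← ofReal_norm, ← ENNReal.ofReal_mul (norm_nonneg _),
      ← ENNReal.ofReal_mul hvk, ← ENNReal.ofReal_mul hC]
    exact ENNReal.ofReal_le_ofReal (weight_mul_norm_shift_le hv φ k x)
  set B := latticeCorr (fun y => ‖F y * ((1 / v y : ℝ) : ℂ)‖ₑ) (fun y => ‖φt y * (ws y : ℂ)‖ₑ) k
  rw [enorm_mul, mul_assoc]
  calc _ ≤ (ENNReal.ofReal (C * v (-latticePt k)) * B) *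
        (‖φ (x + latticePt k)‖ₑ * ‖((1 / v x : ℝ) : ℂ)‖ₑ) := by gcongr
    _ = ENNReal.ofReal C * B * (ENNReal.ofReal (v (-latticePt k)) *
        (‖φ (x + latticePt k)‖ₑ * ‖((1 / v x : ℝ) : ℂ)‖ₑ)) := by
        rw [ENNReal.ofReal_mul hC]; ring
    _ ≤ ENNReal.ofReal C * B *
        (ENNReal.ofReal C * ‖φ (x + latticePt k) * (ws (x + latticePt k) : ℂ)‖ₑ) := by gcongr
    _ = _ := by rw [sq, ENNReal.ofReal_mul hC]; ring

theorem eLpNorm_tsum_enorm_le (hv : IsModerate v ws C)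
    (hp : 1 ≤ p) (hpq : 1 / p + 1 / q = 1) (hφ : MemWCal φ p ws)
    (hφt : MemWCal φt q ws) (hF : MemWLp F p fun x => 1 / v x) :
    eLpNorm (fun x => (∑' k : Fin d → ℤ, ‖pairing F (fun y => φt (y + latticePt k)) *
      φ (x + latticePt k)‖ₑ) * ‖((1 / v x : ℝ) : ℂ)‖ₑ) p volume ≤
      ENNReal.ofReal (C ^ 2) * calNorm (fun x => φt x * (ws x : ℂ)) q *
        calNorm (fun x => φ x * (ws x : ℂ)) p * wNorm F p fun x => 1 / v x := by
  have h := eLpNorm_latticeSynth_latticeCorr_le hp hpq hF.1.enorm hφt.1.1.enorm hφ.1.1.enorm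
    (by rw [← calNorm_eq]; exact hφt.2)
  rw [← calNorm_eq, ← calNorm_eq, eLpNorm_enorm] at h
  have h1 := eLpNorm_le_nnreal_smul_eLpNorm_of_ae_le_mul' (c := (C ^ 2).toNNReal) (p := p)
    (μ := volume) (Filter.Eventually.of_forall fun x =>
      (enorm_eq_self _).trans_le ((tsum_enorm_mul_weight_le hv φ φt F x).trans_eq
        (congrArg _ (enorm_eq_self _).symm)))
  refine h1.trans ?_
  rw [ENNReal.smul_def, smul_eq_mul]
  calc _ ≤ ENNReal.ofReal (C ^ 2) * _ := mul_le_mul_right h _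
    _ = _ := by rw [wNorm]; ring

theorem calNorm_const_lt_top (hφ : MemWCal φ p ws) (hφt : MemWCal φt q ws) :
    ENNReal.ofReal (C ^ 2) * calNorm (fun x => φt x * (ws x : ℂ)) q *
        calNorm (fun x => φ x * (ws x : ℂ)) p < ∞ :=
  ENNReal.mul_lt_top (ENNReal.mul_lt_top ENNReal.ofReal_lt_top hφt.2) hφ.2

/-- The norm bound already holds for the sum of absolute values, which is therefore finite almost
everywhere, as `1 / v` never vanishes. -/
theorem ae_summable_levelZero (hv : IsModerate v ws C) (hp : 1 ≤ p) (hpq : 1 / p + 1 / q = 1)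
    (hφm : AEStronglyMeasurable φ volume) (hφ : MemWCal φ p ws)
    (hφt : MemWCal φt q ws) (hF : MemWLp F p fun x => 1 / v x) :
    ∀ᵐ x, Summable fun k : Fin d → ℤ =>
      pairing F (fun y => φt (y + latticePt k)) * φ (x + latticePt k) := by
  have hfin := lt_of_le_of_lt (eLpNorm_tsum_enorm_le hv hp hpq hφ hφt hF)
    (ENNReal.mul_lt_top (calNorm_const_lt_top hφ hφt) hF.2)
  have hvm : Measurable fun x => ‖((1 / v x : ℝ) : ℂ)‖ₑ :=
    (Complex.measurable_ofReal.comp (hv.measurable.const_div 1)).enorm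
  have hm : AEMeasurable fun x => (∑' k : Fin d → ℤ, ‖pairing F (fun y => φt (y + latticePt k)) *
      φ (x + latticePt k)‖ₑ) * ‖((1 / v x : ℝ) : ℂ)‖ₑ :=
    (AEMeasurable.tsum fun k =>
      ((aemeasurable_comp_add_right hφm.aemeasurable _).const_mul _).enorm).mul hvm.aemeasurable
  filter_upwards [ae_lt_top_of_eLpNorm_lt_top (zero_lt_one.trans_le hp).ne' hm hfin] with x hx
  refine Summable.of_norm (tsum_enorm_ne_top_iff_summable_norm.1 fun htop => ?_)
  rw [htop, ENNReal.top_mul] at hx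
  · exact lt_irrefl _ hx
  · have := (hv.pos x).ne'
    simpa using this

theorem aestronglyMeasurable_levelZero (hφm : AEStronglyMeasurable φ volume) (φt F : E d → ℂ) :
    AEStronglyMeasurable (levelZero φ φt F) volume :=
  (AEMeasurable.tsum fun _ =>
    ((aemeasurable_comp_add_right hφm.aemeasurable _).const_mul _)).aestronglyMeasurable

theorem wNorm_levelZero_le (hv : IsModerate v ws C)
    (hp : 1 ≤ p) (hpq : 1 / p + 1 / q = 1) (hφ : MemWCal φ p ws)
    (hφt : MemWCal φt q ws) (hF : MemWLp F p fun x => 1 / v x) :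
    wNorm (levelZero φ φt F) p (fun x => 1 / v x) ≤
      ENNReal.ofReal (C ^ 2) * calNorm (fun x => φt x * (ws x : ℂ)) q *
        calNorm (fun x => φ x * (ws x : ℂ)) p * wNorm F p fun x => 1 / v x := by
  refine le_trans (eLpNorm_mono_enorm fun x => ?_) (eLpNorm_tsum_enorm_le hv hp hpq hφ hφt hF)
  rw [enorm_mul, enorm_eq_self]
  gcongr
  exact enorm_tsum_le_tsum_enorm

end LevelZero

/-! ### Linear changes of variables. -/

theorem act_mul (A B : Matrix (Fin d) (Fin d) ℝ) (x : E d) : act (A * B) x = act A (act B x) := by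
  simp [act, Matrix.toEuclideanLin, Matrix.toLpLin_mul_same]

theorem act_one (x : E d) : act (1 : Matrix (Fin d) (Fin d) ℝ) x = x := by
  simp [act, Matrix.toEuclideanLin]

theorem act_add (A : Matrix (Fin d) (Fin d) ℝ) (x y : E d) : act A (x + y) = act A x + act A y :=
  map_add _ _ _

theorem continuous_act (A : Matrix (Fin d) (Fin d) ℝ) : Continuous (act A) :=
  (Matrix.toEuclideanLin A).continuous_of_finiteDimensional

theorem act_act_of_mul_eq_one {A B : Matrix (Fin d) (Fin d) ℝ} (h : A * B = 1) (x : E d) :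
    act A (act B x) = x := by
  rw [← act_mul, h, act_one]

theorem inner_act_transpose (A : Matrix (Fin d) (Fin d) ℝ) (x y : E d) :
    inner ℝ (act A.transpose x) y = inner ℝ x (act A y) := by
  rw [act, act, ← Matrix.conjTranspose_eq_transpose_of_trivial,
    Matrix.toEuclideanLin_conjTranspose_eq_adjoint, LinearMap.adjoint_inner_left]

theorem measurableEmbedding_act {A B : Matrix (Fin d) (Fin d) ℝ} (hAB : A * B = 1) :
    MeasurableEmbedding (act A) :=
  let e : E d ≃ₜ E d :=
    { toFun := act A
      invFun := act B
      left_inv := act_act_of_mul_eq_one (mul_eq_one_comm.1 hAB)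
      right_inv := act_act_of_mul_eq_one hAB
      continuous_toFun := continuous_act A
      continuous_invFun := continuous_act B }
  e.measurableEmbedding

theorem det_ne_zero_of_mul_eq_one {A B : Matrix (Fin d) (Fin d) ℝ} (hAB : A * B = 1) :
    A.det ≠ 0 := by
  intro h
  have := congrArg Matrix.det hAB
  simp [Matrix.det_mul, h] at this

theorem map_act_volume {A : Matrix (Fin d) (Fin d) ℝ} (hA : A.det ≠ 0) :
    Measure.map (act A) volume = ENNReal.ofReal |A.det⁻¹| • (volume : Measure (E d)) := by
  have h : LinearMap.det (Matrix.toEuclideanLin A) = A.det := LinearMap.det_toLpLin 2 A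
  have := Measure.map_linearMap_addHaar_eq_smul_addHaar (volume : Measure (E d))
    (f := Matrix.toEuclideanLin A) (by rwa [h])
  rwa [h] at this

theorem quasiMeasurePreserving_act {A : Matrix (Fin d) (Fin d) ℝ} (hA : A.det ≠ 0) :
    Measure.QuasiMeasurePreserving (act A) (volume : Measure (E d)) volume :=
  ⟨(continuous_act A).measurable, by
    rw [map_act_volume hA]; exact Measure.smul_absolutelyContinuous⟩

theorem integral_comp_act {A B : Matrix (Fin d) (Fin d) ℝ} (hAB : A * B = 1) (g : E d → ℂ) :
    ∫ x, g (act A x) = ((|A.det|⁻¹ : ℝ) : ℂ) * ∫ x, g x := by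
  rw [← (measurableEmbedding_act hAB).integral_map, map_act_volume (det_ne_zero_of_mul_eq_one hAB),
    integral_smul_measure, ENNReal.toReal_ofReal (abs_nonneg _), abs_inv, Complex.real_smul]

theorem integrable_comp_act {A B : Matrix (Fin d) (Fin d) ℝ} (hAB : A * B = 1) {g : E d → ℂ}
    (hg : Integrable g) : Integrable fun x => g (act A x) := by
  refine (measurableEmbedding_act hAB).integrable_map_iff.1 ?_
  rw [map_act_volume (det_ne_zero_of_mul_eq_one hAB)]
  exact hg.smul_measure ENNReal.ofReal_ne_top

theorem eLpNorm_comp_act {A B : Matrix (Fin d) (Fin d) ℝ} (hAB : A * B = 1) (g : E d → ℂ)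
    (p : ℝ≥0∞) : eLpNorm (fun x => g (act A x)) p volume =
      ENNReal.ofReal |A.det⁻¹| ^ (1 / p).toReal * eLpNorm g p volume := by
  have hA := det_ne_zero_of_mul_eq_one hAB
  have := (measurableEmbedding_act hAB).eLpNorm_map_measure (μ := volume) (g := g) (p := p)
  rw [map_act_volume hA, eLpNorm_smul_measure_of_ne_zero (by simpa using hA)] at this
  exact this.symm

theorem eLpNorm_comp_act_lt_top {A B : Matrix (Fin d) (Fin d) ℝ} (hAB : A * B = 1) {g : E d → ℂ}
    {p : ℝ≥0∞} (hg : eLpNorm g p volume < ∞) : eLpNorm (fun x => g (act A x)) p volume < ∞ := by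
  rw [eLpNorm_comp_act hAB]
  exact ENNReal.mul_lt_top (ENNReal.rpow_lt_top_of_nonneg ENNReal.toReal_nonneg
    ENNReal.ofReal_ne_top) hg

theorem memLp_comp_act {A B : Matrix (Fin d) (Fin d) ℝ} (hAB : A * B = 1) {g : E d → ℂ}
    {p : ℝ≥0∞} (hg : MemLp g p volume) : MemLp (fun x => g (act A x)) p volume :=
  ⟨hg.1.comp_quasiMeasurePreserving (quasiMeasurePreserving_act (det_ne_zero_of_mul_eq_one hAB)),
    eLpNorm_comp_act_lt_top hAB hg.2⟩

theorem IsDilation.det_ne_zero {M : Matrix (Fin d) (Fin d) ℝ} (hM : IsDilation M) : M.det ≠ 0 := by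
  intro h
  have h0 : (0 : ℂ) ∈ spectrum ℂ (M.map (fun r : ℝ => (r : ℂ))) := by
    rw [spectrum.zero_mem_iff, Matrix.isUnit_iff_isUnit_det]
    have : (M.map (fun r : ℝ => (r : ℂ))).det = ((M.det : ℝ) : ℂ) :=
      (RingHom.map_det Complex.ofRealHom M).symm
    rw [this, h]
    simp
  have := hM 0 h0
  simp at this
  linarith

/-! ### Reduction of level `j` to level zero. -/

section Scaling

variable {M : Matrix (Fin d) (Fin d) ℝ}

theorem pow_mul_inv_pow (hM : M.det ≠ 0) (j : ℕ) : M ^ j * M⁻¹ ^ j = 1 := by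
  rw [Matrix.inv_pow', Matrix.mul_nonsing_inv]
  rw [Matrix.det_pow]
  exact (isUnit_iff_ne_zero.2 hM).pow j

theorem inv_pow_mul_pow (hM : M.det ≠ 0) (j : ℕ) : M⁻¹ ^ j * M ^ j = 1 :=
  mul_eq_one_comm.1 (pow_mul_inv_pow hM j)

theorem rpow_half_mul_self (hM : M.det ≠ 0) (j : ℕ) :
    |M.det| ^ ((j : ℝ) / 2) * |M.det| ^ ((j : ℝ) / 2) = |(M ^ j).det| := by
  rw [← Real.rpow_add (abs_pos.2 hM), add_halves, Real.rpow_natCast, Matrix.det_pow, abs_pow]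

theorem mul_conj_dil_eq (φt f : E d → ℂ) (hM : M.det ≠ 0) (j : ℕ) (k : Fin d → ℤ) (x : E d) :
    f x * conj (dil M φt j k x) = ((|M.det| ^ ((j : ℝ) / 2) : ℝ) : ℂ) *
      (fun y => f (act (M⁻¹ ^ j) y) * conj (φt (y + latticePt k))) (act (M ^ j) x) := by
  simp only [dil, map_mul, Complex.conj_ofReal, act_act_of_mul_eq_one (inv_pow_mul_pow hM j)]
  ring

/-- The two normalizing factors `m^{j/2}` cancel the Jacobian of `x ↦ M^j x`. -/
theorem pairing_dil_mul_dil (φ φt f : E d → ℂ) (hM : M.det ≠ 0) (j : ℕ) (k : Fin d → ℤ) (x : E d) :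
    pairing f (dil M φt j k) * dil M φ j k x =
      pairing (fun y => f (act (M⁻¹ ^ j) y)) (fun y => φt (y + latticePt k)) *
        φ (act (M ^ j) x + latticePt k) := by
  have hdet := abs_ne_zero.2 (det_ne_zero_of_mul_eq_one (pow_mul_inv_pow hM j))
  have h1 : pairing f (dil M φt j k) = ((|M.det| ^ ((j : ℝ) / 2) : ℝ) : ℂ) *
      (((|(M ^ j).det|⁻¹ : ℝ) : ℂ) *
        pairing (fun y => f (act (M⁻¹ ^ j) y)) (fun y => φt (y + latticePt k))) := by
    rw [pairing, pairing, ← integral_comp_act (pow_mul_inv_pow hM j), ← integral_const_mul]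
    exact integral_congr_ae (Filter.Eventually.of_forall fun x => mul_conj_dil_eq φt f hM j k x)
  have h2 : ((|M.det| ^ ((j : ℝ) / 2) : ℝ) : ℂ) * ((|M.det| ^ ((j : ℝ) / 2) : ℝ) : ℂ) *
      ((|(M ^ j).det|⁻¹ : ℝ) : ℂ) = 1 := by
    rw [← Complex.ofReal_mul, rpow_half_mul_self hM, ← Complex.ofReal_mul, mul_inv_cancel₀ hdet,
      Complex.ofReal_one]
  rw [h1, dil]
  linear_combination (pairing (fun y => f (act (M⁻¹ ^ j) y)) (fun y => φt (y + latticePt k)) *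
        φ (act (M ^ j) x + latticePt k)) * h2

theorem quasiProj_eq_levelZero (φ φt f : E d → ℂ) (hM : M.det ≠ 0) (j : ℕ) (x : E d) :
    quasiProj M φ φt j f x = levelZero φ φt (fun y => f (act (M⁻¹ ^ j) y)) (act (M ^ j) x) :=
  tsum_congr fun k => pairing_dil_mul_dil φ φt f hM j k x

/-- A band-limited function, rescaled so that its spectrum lies in a ball. -/
theorem exists_fourierInv_of_bandLimited (hM : M.det ≠ 0) (j : ℕ) {δ : ℝ} {g : E d → ℂ}
    (hg : BandLimited g {ξ | ‖act (M.transpose⁻¹ ^ j) ξ‖ < δ}) :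
    ∃ H : E d → ℂ, Integrable H ∧ (∀ᵐ ξ, ¬ ‖ξ‖ < δ → H ξ = 0) ∧
      (fun y => g (act (M⁻¹ ^ j) y)) =ᵐ[volume] 𝓕⁻ H := by
  obtain ⟨hg2, hsupp⟩ := hg
  have hMt : M.transpose.det ≠ 0 := by rwa [Matrix.det_transpose]
  have hN := pow_mul_inv_pow hMt j
  have hN' := inv_pow_mul_pow hMt j
  set h : E d → ℂ := ((𝓕 (hg2.toLp g) : Lp ℂ 2 (volume : Measure (E d))) : E d → ℂ)
  have hmeas : MeasurableSet {ξ : E d | ‖act (M.transpose⁻¹ ^ j) ξ‖ < δ} :=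
    (isOpen_lt (continuous_act _).norm continuous_const).measurableSet
  have hfin : volume {ξ : E d | ‖act (M.transpose⁻¹ ^ j) ξ‖ < δ} < ∞ := by
    have e : {ξ : E d | ‖act (M.transpose⁻¹ ^ j) ξ‖ < δ} =
        act (M.transpose⁻¹ ^ j) ⁻¹' Metric.ball 0 δ := by ext; simp
    rw [e, ← (measurableEmbedding_act hN').map_apply,
      map_act_volume (det_ne_zero_of_mul_eq_one hN'), Measure.smul_apply, smul_eq_mul]
    exact ENNReal.mul_lt_top ENNReal.ofReal_lt_top measure_ball_lt_top
  have hint : Integrable h := integrable_of_memLp_two_of_suppIn (Lp.memLp _) hmeas hfin hsupp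
  have hginv := ae_eq_fourierInv_of_integrable_fourier hg2 hint
  have hdet := abs_ne_zero.2 (det_ne_zero_of_mul_eq_one hN)
  -- Dilating `g` by `M^{-j}` dilates its transform by the transpose of `M^j`, with the Jacobian as
  -- factor; this carries the ellipsoid to the ball of radius `δ`.
  refine ⟨fun η => ((|(M.transpose ^ j).det| : ℝ) : ℂ) * h (act (M.transpose ^ j) η),
    (integrable_comp_act hN hint).const_mul _, ?_, ?_⟩
  · filter_upwards [(quasiMeasurePreserving_act (det_ne_zero_of_mul_eq_one hN)).ae hsupp]
      with η h1 h2
    rw [h1, mul_zero]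
    rwa [act_act_of_mul_eq_one hN']
  · have hB := quasiMeasurePreserving_act (det_ne_zero_of_mul_eq_one (inv_pow_mul_pow hM j))
    filter_upwards [hB.ae hginv] with y hy
    rw [hy, fourierInv_eq_expChar, fourierInv_eq_expChar]
    have h1 := integral_comp_act hN fun ξ => expChar ξ (act (M⁻¹ ^ j) y) * h ξ
    have h2 : ∀ η, expChar (act (M.transpose ^ j) η) (act (M⁻¹ ^ j) y) = expChar η y := by
      intro η
      rw [expChar, ← Matrix.transpose_pow, inner_act_transpose,
        act_act_of_mul_eq_one (pow_mul_inv_pow hM j), expChar]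
    simp only [h2] at h1
    have h3 : ∀ η, expChar η y * (((|(M.transpose ^ j).det| : ℝ) : ℂ) *
        h (act (M.transpose ^ j) η)) = ((|(M.transpose ^ j).det| : ℝ) : ℂ) *
          (expChar η y * h (act (M.transpose ^ j) η)) := fun η => by ring
    simp only [h3]
    rw [integral_const_mul, h1, ← mul_assoc, ← Complex.ofReal_mul, mul_inv_cancel₀ hdet,
      Complex.ofReal_one, one_mul]

end Scaling

/-! ### Consequences of the weight axioms. -/

section Weight

variable {α : ℝ} {w ws : E d → ℝ}

theorem IsWeight.pos (hw : IsWeight α w ws) (x : E d) : 0 < w x :=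
  zero_lt_one.trans_le (hw.one_le x)

/-- Follows from `1 ≤ w (x + 0) ≤ ws x * w 0`. This positive lower bound makes division by `ws`
harmless, so weighted generators are integrable. -/
theorem IsWeight.inv_le_star (hw : IsWeight α w ws) (x : E d) : (w 0)⁻¹ ≤ ws x := by
  have h := (hw.one_le (x + 0)).trans (hw.submul x 0)
  rw [← one_div, div_le_iff₀ (hw.pos 0)]
  exact h

theorem IsWeight.star_pos (hw : IsWeight α w ws) (x : E d) : 0 < ws x :=
  (inv_pos.2 (hw.pos 0)).trans_le (hw.inv_le_star x)

theorem IsWeight.eq_mul_inv_star (hw : IsWeight α w ws) (φ : E d → ℂ) :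
    φ = fun x => φ x * (ws x : ℂ) * (((ws x)⁻¹ : ℝ) : ℂ) := by
  ext x
  have : (ws x : ℂ) ≠ 0 := Complex.ofReal_ne_zero.2 (hw.star_pos x).ne'
  push_cast
  field_simp

theorem IsWeight.integrable_of_memWCal (hw : IsWeight α w ws) {φ : E d → ℂ} {p : ℝ≥0∞}
    (hp : 1 ≤ p) (h : MemWCal φ p ws) : Integrable φ := by
  rw [hw.eq_mul_inv_star φ]
  refine (MemCal.integrable hp h).mul_bdd (c := w 0)
    (Complex.measurable_ofReal.comp hw.star_measurable.inv).aestronglyMeasurable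
    (Filter.Eventually.of_forall fun x => ?_)
  rw [Complex.norm_real, Real.norm_eq_abs, abs_of_pos (inv_pos.2 (hw.star_pos x))]
  exact (inv_le_comm₀ (hw.pos 0) (hw.star_pos x)).1 (hw.inv_le_star x)

/-- The same `C` serves every `j`, so the level-zero bound is uniform over the rescaled weights. -/
theorem IsWeight.isModerate (hw : IsWeight α w ws) {M : Matrix (Fin d) (Fin d) ℝ} {C : ℝ}
    (hC : 0 ≤ C) (h : ∀ (j : ℕ) (x : E d), ws (act (M⁻¹ ^ j) x) ≤ C * ws x) (j : ℕ) :
    IsModerate (fun x => w (act (M⁻¹ ^ j) x)) ws C where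
  pos x := hw.pos _
  measurable := hw.continuous.measurable.comp (continuous_act _).measurable
  const_nonneg := hC
  star_even := hw.star_even
  star_nonneg := hw.star_nonneg
  submul x y := by
    rw [act_add]
    refine (hw.submul _ _).trans ?_
    gcongr
    · exact (hw.pos _).le
    · exact h j x

end Weight

/-! ### Boundedness, reproduction and approximation at level `j`. -/

section Level

variable {w ws : E d → ℝ} {M : Matrix (Fin d) (Fin d) ℝ} {j : ℕ} {C : ℝ} {φ φt f : E d → ℂ}
  {p q : ℝ≥0∞}

theorem memWLp_comp_act (hM : M.det ≠ 0) (j : ℕ) (hf : MemWLp f p fun x => 1 / w x) :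
    MemWLp (fun y => f (act (M⁻¹ ^ j) y)) p fun y => 1 / w (act (M⁻¹ ^ j) y) :=
  memLp_comp_act (inv_pow_mul_pow hM j) hf

theorem integrable_mul_conj_dil (hM : M.det ≠ 0)
    (hv : IsModerate (fun x => w (act (M⁻¹ ^ j) x)) ws C) (hpq : 1 / p + 1 / q = 1)
    (hφtm : AEStronglyMeasurable φt volume) (hφt : MemWCal φt q ws)
    (hf : MemWLp f p fun x => 1 / w x) (k : Fin d → ℤ) :
    Integrable fun x => f x * conj (dil M φt j k x) := by
  simp only [mul_conj_dil_eq φt f hM j k]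
  exact (integrable_comp_act (pow_mul_inv_pow hM j)
    (integrable_mul_conj_shift hv hpq hφtm hφt (memWLp_comp_act hM j hf) k)).const_mul _

theorem ae_summable_quasiProj (hM : M.det ≠ 0)
    (hv : IsModerate (fun x => w (act (M⁻¹ ^ j) x)) ws C) (hp : 1 ≤ p) (hpq : 1 / p + 1 / q = 1)
    (hφm : AEStronglyMeasurable φ volume) (hφ : MemWCal φ p ws) (hφt : MemWCal φt q ws)
    (hf : MemWLp f p fun x => 1 / w x) :
    ∀ᵐ x, Summable fun k : Fin d → ℤ => pairing f (dil M φt j k) * dil M φ j k x := by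
  have h := (quasiMeasurePreserving_act (det_ne_zero_of_mul_eq_one (pow_mul_inv_pow hM j))).ae
    (ae_summable_levelZero hv hp hpq hφm hφ hφt (memWLp_comp_act hM j hf))
  filter_upwards [h] with x hx
  simpa only [pairing_dil_mul_dil φ φt f hM j] using hx

theorem quasiProj_mul_weight_eq (hM : M.det ≠ 0) (x : E d) :
    quasiProj M φ φt j f x * ((1 / w x : ℝ) : ℂ) =
      (fun y => levelZero φ φt (fun y => f (act (M⁻¹ ^ j) y)) y *
        ((1 / w (act (M⁻¹ ^ j) y) : ℝ) : ℂ)) (act (M ^ j) x) := by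
  simp only [act_act_of_mul_eq_one (inv_pow_mul_pow hM j), quasiProj_eq_levelZero φ φt f hM j x]

/-- Undoing the dilation multiplies both norms by the same power of the Jacobian, so the level-zero
constant survives unchanged. -/
theorem wNorm_quasiProj_le (hM : M.det ≠ 0)
    (hv : IsModerate (fun x => w (act (M⁻¹ ^ j) x)) ws C) (hp : 1 ≤ p) (hpq : 1 / p + 1 / q = 1)
    (hφ : MemWCal φ p ws) (hφt : MemWCal φt q ws) (hf : MemWLp f p fun x => 1 / w x) :
    wNorm (quasiProj M φ φt j f) p (fun x => 1 / w x) ≤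
      ENNReal.ofReal (C ^ 2) * calNorm (fun x => φt x * (ws x : ℂ)) q *
        calNorm (fun x => φ x * (ws x : ℂ)) p * wNorm f p fun x => 1 / w x := by
  have hAB := pow_mul_inv_pow hM j
  have h := wNorm_levelZero_le hv hp hpq hφ hφt (memWLp_comp_act hM j hf)
  have e : wNorm f p (fun x => 1 / w x) = ENNReal.ofReal |(M ^ j).det⁻¹| ^ (1 / p).toReal *
      wNorm (fun y => f (act (M⁻¹ ^ j) y)) p fun y => 1 / w (act (M⁻¹ ^ j) y) := by
    rw [wNorm, wNorm, ← eLpNorm_comp_act hAB]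
    simp only [act_act_of_mul_eq_one (inv_pow_mul_pow hM j)]
  rw [e, wNorm]
  simp only [quasiProj_mul_weight_eq hM]
  rw [eLpNorm_comp_act hAB (fun y => levelZero φ φt (fun y => f (act (M⁻¹ ^ j) y)) y *
    ((1 / w (act (M⁻¹ ^ j) y) : ℝ) : ℂ)), mul_left_comm]
  exact mul_le_mul_right h _

theorem memWLp_quasiProj (hM : M.det ≠ 0)
    (hv : IsModerate (fun x => w (act (M⁻¹ ^ j) x)) ws C) (hp : 1 ≤ p) (hpq : 1 / p + 1 / q = 1)
    (hφm : AEStronglyMeasurable φ volume) (hφ : MemWCal φ p ws) (hφt : MemWCal φt q ws)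
    (hf : MemWLp f p fun x => 1 / w x) :
    MemWLp (quasiProj M φ φt j f) p fun x => 1 / w x := by
  refine ⟨?_, lt_of_le_of_lt (wNorm_quasiProj_le hM hv hp hpq hφ hφt hf)
    (ENNReal.mul_lt_top (calNorm_const_lt_top hφ hφt) hf.2)⟩
  simp only [quasiProj_mul_weight_eq hM]
  refine AEStronglyMeasurable.comp_quasiMeasurePreserving (g := fun y =>
    levelZero φ φt (fun y => f (act (M⁻¹ ^ j) y)) y * ((1 / w (act (M⁻¹ ^ j) y) : ℝ) : ℂ)) ?_
    (quasiMeasurePreserving_act (det_ne_zero_of_mul_eq_one (pow_mul_inv_pow hM j)))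
  exact (aestronglyMeasurable_levelZero hφm _ _).mul
    (Complex.measurable_ofReal.comp (hv.measurable.const_div 1)).aestronglyMeasurable

/-- Quasi-projections reproduce band-limited functions. -/
theorem quasiProj_ae_eq_of_bandLimited (hM : M.det ≠ 0) (j : ℕ) (hφ : Integrable φ)
    (hφt : Integrable φt) {δ : ℝ} (hcomp : StrictlyCompatible φ φt δ)
    (hδφ : ∀ l : Fin d → ℤ, l ≠ 0 → ∀ᵐ ξ : E d, ‖ξ - latticePt l‖ < δ → 𝓕 φ ξ = 0)
    {g : E d → ℂ} (hg : BandLimited g {ξ | ‖act (M.transpose⁻¹ ^ j) ξ‖ < δ}) :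
    quasiProj M φ φt j g =ᵐ[volume] g := by
  obtain ⟨H, hH, hHs, hG⟩ := exists_fourierInv_of_bandLimited hM j hg
  have h := (quasiMeasurePreserving_act (det_ne_zero_of_mul_eq_one (pow_mul_inv_pow hM j))).ae
    (ae_tsum_eq_of_bandLimited hφ hφt hcomp hδφ hH hHs hG)
  filter_upwards [h] with x hx
  rw [quasiProj_eq_levelZero φ φt g hM j, levelZero, hx,
    act_act_of_mul_eq_one (inv_pow_mul_pow hM j)]

/-- Linearity is not automatic for `tsum` and the Bochner integral; it uses summability for both
functions at `x` and integrability of both pairings. -/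
theorem quasiProj_sub_ae_eq (hM : M.det ≠ 0)
    (hv : IsModerate (fun x => w (act (M⁻¹ ^ j) x)) ws C) (hp : 1 ≤ p) (hpq : 1 / p + 1 / q = 1)
    (hφm : AEStronglyMeasurable φ volume) (hφtm : AEStronglyMeasurable φt volume)
    (hφ : MemWCal φ p ws) (hφt : MemWCal φt q ws) {g : E d → ℂ}
    (hf : MemWLp f p fun x => 1 / w x) (hg : MemWLp g p fun x => 1 / w x) :
    ∀ᵐ x, quasiProj M φ φt j (fun x => f x - g x) x =
      quasiProj M φ φt j f x - quasiProj M φ φt j g x := by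
  filter_upwards [ae_summable_quasiProj hM hv hp hpq hφm hφ hφt hf,
    ae_summable_quasiProj hM hv hp hpq hφm hφ hφt hg] with x h1 h2
  rw [quasiProj, quasiProj, quasiProj, ← h1.tsum_sub h2]
  refine tsum_congr fun k => ?_
  rw [← sub_mul]
  congr 1
  rw [pairing, pairing, pairing, ← integral_sub (integrable_mul_conj_dil hM hv hpq hφtm hφt hf k)
    (integrable_mul_conj_dil hM hv hpq hφtm hφt hg k)]
  simp only [sub_mul]

theorem wNorm_sub_quasiProj_le (hM : M.det ≠ 0)
    (hv : IsModerate (fun x => w (act (M⁻¹ ^ j) x)) ws C) (hp : 1 ≤ p) (hpq : 1 / p + 1 / q = 1)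
    (hφi : Integrable φ) (hφti : Integrable φt) (hφ : MemWCal φ p ws) (hφt : MemWCal φt q ws)
    {δ : ℝ} (hcomp : StrictlyCompatible φ φt δ)
    (hδφ : ∀ l : Fin d → ℤ, l ≠ 0 → ∀ᵐ ξ : E d, ‖ξ - latticePt l‖ < δ → 𝓕 φ ξ = 0)
    {g : E d → ℂ} (hf : MemWLp f p fun x => 1 / w x) (hg : MemWLp g p fun x => 1 / w x)
    (hgb : BandLimited g {ξ | ‖act (M.transpose⁻¹ ^ j) ξ‖ < δ}) :
    wNorm (fun x => f x - quasiProj M φ φt j f x) p (fun x => 1 / w x) ≤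
      (1 + ENNReal.ofReal (C ^ 2) * calNorm (fun x => φt x * (ws x : ℂ)) q *
        calNorm (fun x => φ x * (ws x : ℂ)) p) * wNorm (fun x => f x - g x) p fun x => 1 / w x := by
  have hfg : MemWLp (fun x => f x - g x) p fun x => 1 / w x := by
    have := MemLp.sub hf hg
    refine this.ae_eq (Filter.Eventually.of_forall fun x => ?_)
    simp [sub_mul]
  have hQ := memWLp_quasiProj (j := j) hM hv hp hpq hφi.1 hφ hφt hfg
  have heq : wNorm (fun x => f x - quasiProj M φ φt j f x) p (fun x => 1 / w x) =
      eLpNorm ((fun x => (f x - g x) * ((1 / w x : ℝ) : ℂ)) - fun x =>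
        quasiProj M φ φt j (fun x => f x - g x) x * ((1 / w x : ℝ) : ℂ)) p volume := by
    refine eLpNorm_congr_ae ?_
    filter_upwards [quasiProj_sub_ae_eq hM hv hp hpq hφi.1 hφti.1 hφ hφt hf hg,
      quasiProj_ae_eq_of_bandLimited hM j hφi hφti hcomp hδφ hgb] with x h1 h2
    rw [Pi.sub_apply, h1, h2]
    ring
  rw [heq, add_mul, one_mul]
  exact (eLpNorm_sub_le hfg.1 hQ.1 hp).trans
    (add_le_add le_rfl (wNorm_quasiProj_le hM hv hp hpq hφ hφt hfg))

end Level

end QuasiProj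

end

theorem theorem7 {d : ℕ} (p q : ℝ≥0∞) (hp : 1 ≤ p) (hpq : 1 / p + 1 / q = 1)
    (α : ℝ) (hα : 0 < α) (w ws : QuasiProj.E d → ℝ) (hw : QuasiProj.IsWeight α w ws)
    (M : Matrix (Fin d) (Fin d) ℝ) (hM : QuasiProj.IsDilation M)
    (φ φt : QuasiProj.E d → ℂ)
    (hφ : QuasiProj.MemWCal φ p ws) (hφ2 : MemLp φ 2 volume)
    (hφt : QuasiProj.MemWCal φt q ws)
    (δ : ℝ) (hδ : 0 < δ) (hcomp : QuasiProj.StrictlyCompatible φ φt δ)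
    (hsupp : QuasiProj.SuppIn (𝓕 φ) {ξ | ∀ i, ξ i ∈ Ioo (-1 : ℝ) 1})
    (hδφ : ∀ l : Fin d → ℤ, l ≠ 0 →
      ∀ᵐ ξ : QuasiProj.E d, ‖ξ - QuasiProj.latticePt l‖ < δ → 𝓕 φ ξ = 0) :
    ∃ C : ℝ≥0, ∀ f : QuasiProj.E d → ℂ, QuasiProj.MemWLp f p (fun x => 1 / w x) → ∀ j : ℕ,
      (∀ k : Fin d → ℤ,
        Integrable (fun x => f x * conj (QuasiProj.dil M φt j k x)) volume) ∧
      (∀ᵐ x : QuasiProj.E d, Summable (fun k : Fin d → ℤ =>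
        QuasiProj.pairing f (QuasiProj.dil M φt j k) * QuasiProj.dil M φ j k x)) ∧
      QuasiProj.MemWLp (QuasiProj.quasiProj M φ φt j f) p (fun x => 1 / w x) ∧
      QuasiProj.wNorm (fun x => f x - QuasiProj.quasiProj M φ φt j f x) p (fun x => 1 / w x) ≤
        C * QuasiProj.bestApprox {ξ | ‖QuasiProj.act (M.transpose⁻¹ ^ j) ξ‖ < δ} f p
          (fun x => 1 / w x) := by
  have hq : 1 ≤ q := by
    rw [← ENNReal.inv_le_one]
    calc q⁻¹ ≤ 1 / p + 1 / q := by simp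
      _ = 1 := hpq
  have hdet := hM.det_ne_zero
  have hφi := hw.integrable_of_memWCal hp hφ
  have hφti := hw.integrable_of_memWCal hq hφt
  obtain ⟨C, hC, hCw⟩ := hw.dilation M hM
  have hv := fun j => hw.isModerate hC.le hCw j
  -- One plus the operator bound for `Q_j`; neither `j` nor `f` enters.
  set K : ℝ≥0∞ := 1 + ENNReal.ofReal (C ^ 2) * QuasiProj.calNorm (fun x => φt x * (ws x : ℂ)) q *
    QuasiProj.calNorm (fun x => φ x * (ws x : ℂ)) p
  have hfin : K ≠ ∞ :=
    ENNReal.add_ne_top.2 ⟨ENNReal.one_ne_top, (QuasiProj.calNorm_const_lt_top hφ hφt).ne⟩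
  refine ⟨K.toNNReal, fun f hf j => ⟨fun k =>
    QuasiProj.integrable_mul_conj_dil hdet (hv j) hpq hφti.1 hφt hf k,
    QuasiProj.ae_summable_quasiProj hdet (hv j) hp hpq hφi.1 hφ hφt hf,
    QuasiProj.memWLp_quasiProj hdet (hv j) hp hpq hφi.1 hφ hφt hf, ?_⟩⟩
  -- Since `K` is finite and nonzero, it passes through both infima, over `g` and over the
  -- membership condition.
  rw [ENNReal.coe_toNNReal hfin, QuasiProj.bestApprox,
    ENNReal.mul_iInf_of_ne (by simp [K]) hfin]
  refine le_iInf fun g => ?_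
  rw [ENNReal.mul_iInf_of_ne (by simp [K]) hfin]
  exact le_iInf fun hg => QuasiProj.wNorm_sub_quasiProj_le hdet (hv j) hp hpq hφi hφti hφ hφt hcomp
    hδφ hf hg.1 hg.2
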